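/- Let $f:[0,\infty)\to\mathbb R$ be smooth with $f(r)>0$ for $r>0$, $f(r)=r+O(r^3)$ as $r\to0$, and $f'(r)\ge 1$ for all $r\ge 0$, and let $\Phi:\mathbb R\to\mathbb R$ be smooth. On $\mathbb R^4$ with coordinates $(t,x,y,z)$ put $r=\sqrt{x^2+y^2+z^2}$, $\eta=-dt^2+dx^2+dy^2+dz^2$, $\mathcal O=(0,0,0,0)$, \[ \zeta=\frac{t^2}{2}-\int_0^r\frac{f(s)}{f'(s)}\,ds,\qquad g=e^{2\Phi(\zeta)}\eta ,\qquad M=\{t>f(r)\},\qquad M_\varepsilon=\{t>(1+\varepsilon)f(r)\}\ \ (\varepsilon>0), \] time-oriented by $\partial_t$, and let $u=-\nabla\zeta/|\nabla\zeta|_g$ on $M$. Let $T=\frac1{8\pi}\left(\mathrm{Ric}-\frac12Rg\right)$ be the energy-momentum tensor of $g$. Then $g$ is a $C^2$ Lorentzian metric on $\mathbb R^4$. Each of the regions $N=M$ and $N=M_\varepsilon$, $\varepsilon>0$, is a connected open proper subset of $\mathbb R^4$, $u$ is a $C^1$ unit future directed timelike vector field on it, and the following hold. (a) $\mathcal O$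 is an origin point for $u$ on $N$: $\mathcal O\notin N$, and each maximal integral curve of $u$ in $N$ can be parameterized by translation as $\gamma:(0,b)\to N$, $0<b\le\infty$, with $\lim_{\tau\to0}\gamma(\tau)=\mathcal O$; extended by $\tilde\gamma(0)=\mathcal O$, its one-sided derivative $\tilde\gamma'(0)$ exists and equals $\lim_{\tau\to0}\gamma'(\tau)$. (c) $N$ is locally timelike convex near $\mathcal O$ about some integral curve $\gamma$ of $u$: there are $\delta\in(0,1)$ and a smooth coordinate neighborhood $U\subset\mathbb R^4$ centered at $\mathcal O$, with coordinates $(x^0,\dots,x^3)$, such that $g_{\mu\nu}(\mathcal O)=\eta_{\mu\nu}$, $|g_{\mu\nu}-\eta_{\mu\nu}|<\delta$ on $U$, $\partial_0|_{\mathcal O}=\tilde\gamma'(0)$, and the timelike future of $\mathcal O$ within $U$ for the metric $-\frac{\delta}{2-\delta}(dx^0)^2+\delta_{ij}dx^idx^j$ is contained in $N$. (d) The Ricci tensor of $(N,g)$ extends continuously to $N\cup\{\mathcal O\}$. (e) $(\mathbb R^4,g)$ is strongly causal at $\mathcal O$. Moreover, for each $\varepsilon>0$, with \[ \rho_0=-p_0=\frac{3}{4\pi}e^{-2\Phi(0)}\Phi'(0),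 \] the following holds on $M_\varepsilon$, and no other pair $(\rho_0,p_0)$ of real numbers has this property. (b) $T$ limits to the perfect fluid $(u,\rho_0,p_0)$ at $\mathcal O$: the function $T(u,u)$ extends continuously to $M_\varepsilon\cup\{\mathcal O\}$ with value $\rho_0$ at $\mathcal O$; for each continuous unit spacelike vector field $e$ on $M_\varepsilon$ orthogonal to $u$, the function $T(e,e)$ extends continuously to $M_\varepsilon\cup\{\mathcal O\}$ with value $p_0$ at $\mathcal O$; and $T-\left[(\rho_0+p_0)\,u_*\otimes u_*+p_0\,g\right]$, where $u_*=g(u,\cdot)$, extends continuously to $M_\varepsilon\cup\{\mathcal O\}$ with value $0$ at $\mathcal O$. Finally, $\mathrm{Ric}|_{\mathcal O}=8\pi\rho_0\,g|_{\mathcal O}$, both for the continuous extension of the Ricci tensor from $M_\varepsilon$ and for the Ricci tensor of $g$ on $\mathbb R^4$. -/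

import Mathlib

open Set Filter Topology MeasureTheory
open scoped Matrix ContDiff NNReal

noncomputable section

/-! ### Tensor calculus for metrics on `ℝ⁴` and its open subsets, in coordinates `(t, x, y, z)` -/

/-- Points and tangent vectors of `ℝ⁴`; the indices `0, 1, 2, 3` are `t, x, y, z`. -/
abbrev R4 : Type := Fin 4 → ℝ

/-- A covariant 2-tensor field, given by its components `p ↦ (A p)_{μν}`. -/
abbrev TwoTensor : Type := R4 → Matrix (Fin 4) (Fin 4) ℝ

/-- The coordinate vector `∂_μ`. -/
def coordVec (μ : Fin 4) : R4 := Pi.single μ 1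

/-- The value `A(v, w)` of a bilinear form with matrix `A`. -/
def bil (A : Matrix (Fin 4) (Fin 4) ℝ) (v w : R4) : ℝ := v ⬝ᵥ (A *ᵥ w)

/-- The partial derivative `∂_μ F` at `p`. -/
def partialD (μ : Fin 4) (F : R4 → ℝ) (p : R4) : ℝ := fderiv ℝ F p (coordVec μ)

/-- The Minkowski metric `η = -dt² + dx² + dy² + dz²`. -/
def minkowski : Matrix (Fin 4) (Fin 4) ℝ := Matrix.diagonal ![-1, 1, 1, 1]

/-- A symmetric bilinear form of signature `(-,+,+,+)`: some basis brings it to Minkowski form. -/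
def IsLorentzian (A : Matrix (Fin 4) (Fin 4) ℝ) : Prop :=
  ∃ B : Matrix (Fin 4) (Fin 4) ℝ, IsUnit B.det ∧ Bᵀ * A * B = minkowski

/-- Christoffel symbols `Γ^k_{ij}` of the Levi-Civita connection of `g`. -/
def christoffel (g : TwoTensor) (k i j : Fin 4) (p : R4) : ℝ :=
  (1 / 2) * ∑ l, (g p)⁻¹ k l *
    (partialD i (fun q => g q j l) p + partialD j (fun q => g q i l) p
      - partialD l (fun q => g q i j) p)

/-- The Ricci tensor of `g`. -/
def ricci (g : TwoTensor) : TwoTensor := fun p => Matrix.of fun i j =>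
  (∑ k, partialD k (christoffel g k i j) p) - (∑ k, partialD j (christoffel g k i k) p)
    + (∑ k, ∑ l, christoffel g k k l p * christoffel g l i j p)
    - ∑ k, ∑ l, christoffel g k j l p * christoffel g l i k p

/-- The scalar curvature of `g`. -/
def scalarCurv (g : TwoTensor) (p : R4) : ℝ := ∑ i, ∑ j, (g p)⁻¹ i j * ricci g p i j

/-- The energy-momentum tensor `T = (1 / 8π) (Ric - (1/2) R g)`. -/
def energyMomentum (g : TwoTensor) : TwoTensor := fun p =>
  (1 / (8 * Real.pi)) • (ricci g p - ((1 / 2) * scalarCurv g p) • g p)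

/-- The gradient `(∇h)^μ = g^{μν} ∂_ν h`. -/
def metricGradient (g : TwoTensor) (h : R4 → ℝ) (p : R4) : R4 :=
  (g p)⁻¹ *ᵥ fun ν => partialD ν h p

/-- The length `|v|_g = √|g(v,v)|` of a vector `v` at `p`. -/
def vecNorm (g : TwoTensor) (p v : R4) : ℝ := Real.sqrt |bil (g p) v v|

/-! ### Spacetimes, causality -/

/-- `(M, g)` is a `C^k` spacetime on the open connected set `M ⊆ ℝ⁴`, time-oriented by the
continuous timelike vector field `X`. -/
structure IsSpacetime (k : ℕ∞) (M : Set R4) (g : TwoTensor) (X : R4 → R4) : Prop where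
  isOpen : IsOpen M
  connected : IsConnected M
  contDiff : ∀ μ ν, ContDiffOn ℝ k (fun p => g p μ ν) M
  lorentzian : ∀ p ∈ M, IsLorentzian (g p)
  orientation_continuous : ContinuousOn X M
  orientation_timelike : ∀ p ∈ M, bil (g p) (X p) (X p) < 0

/-- `u` is a (`C¹`) unit future directed timelike vector field on `M`. -/
structure IsUnitFutureTimelikeField (M : Set R4) (g : TwoTensor) (X u : R4 → R4) : Prop where
  contDiff : ContDiffOn ℝ 1 u M
  unit : ∀ p ∈ M, bil (g p) (u p) (u p) = -1
  future : ∀ p ∈ M, bil (g p) (X p) (u p) < 0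

/-- Future directed causal curves `γ : [a, b] → ℝ⁴`: Lipschitz curves whose velocity is almost
everywhere a nonzero future directed causal vector. -/
def IsFutureCausalCurve (g : TwoTensor) (X : R4 → R4) (γ : ℝ → R4) (a b : ℝ) : Prop :=
  (∃ K : ℝ≥0, LipschitzOnWith K γ (Icc a b)) ∧
    ∀ᵐ s ∂(volume.restrict (Icc a b)),
      deriv γ s ≠ 0 ∧ bil (g (γ s)) (deriv γ s) (deriv γ s) ≤ 0 ∧
        bil (g (γ s)) (X (γ s)) (deriv γ s) < 0

/-- Future directed timelike curves: causal curves with `g(γ', γ') < -δ` almost everywhere for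
some `δ > 0`. -/
def IsFutureTimelikeCurve (g : TwoTensor) (X : R4 → R4) (γ : ℝ → R4) (a b : ℝ) : Prop :=
  IsFutureCausalCurve g X γ a b ∧
    ∃ δ > 0, ∀ᵐ s ∂(volume.restrict (Icc a b)),
      bil (g (γ s)) (deriv γ s) (deriv γ s) < -δ

/-- The timelike future `I⁺(p, U)`: endpoints of future directed timelike curves in `U` that
start at `p`. -/
def timelikeFuture (g : TwoTensor) (X : R4 → R4) (p : R4) (U : Set R4) : Set R4 :=
  {q | ∃ (γ : ℝ → R4) (a b : ℝ), a < b ∧ IsFutureTimelikeCurve g X γ a b ∧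
    (∀ s ∈ Icc a b, γ s ∈ U) ∧ γ a = p ∧ γ b = q}

/-- `(ℝ⁴, g)` is strongly causal at `O`. -/
def StronglyCausalAt (g : TwoTensor) (X : R4 → R4) (O : R4) : Prop :=
  ∀ U ∈ 𝓝 O, ∃ V ∈ 𝓝 O, V ⊆ U ∧ ∀ (γ : ℝ → R4) (a b : ℝ), a < b →
    IsFutureCausalCurve g X γ a b → γ a ∈ V → γ b ∈ V → ∀ s ∈ Icc a b, γ s ∈ U

/-! ### Origin points, perfect fluid limits, local timelike convexity -/

/-- `γ : I → M` is an integral curve of `u`, with `I` a nonempty open interval. -/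
def IsIntegralCurveIn (M : Set R4) (u : R4 → R4) (γ : ℝ → R4) (I : Set ℝ) : Prop :=
  I.Nonempty ∧ IsOpen I ∧ I.OrdConnected ∧ MapsTo γ I M ∧ IsIntegralCurveOn γ (fun _ => u) I

/-- `γ : I → M` is a maximal integral curve of `u` in `M`. -/
def IsMaximalIntegralCurveIn (M : Set R4) (u : R4 → R4) (γ : ℝ → R4) (I : Set ℝ) : Prop :=
  IsIntegralCurveIn M u γ I ∧
    ∀ (γ' : ℝ → R4) (J : Set ℝ), IsIntegralCurveIn M u γ' J → I ⊆ J → EqOn γ γ' I → J = I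

/-- `O` is an origin point for the vector field `u` on `M`: the parameter interval of each
(maximal) integral curve `γ` of `u` has a finite lower end `a` (which is `0` after a translation
of the parameter), `γ(τ) → O` as `τ → a⁺`, and the curve extended by `γ(a) = O` has a one-sided
derivative at `a` that is the limit of `γ'(τ)`. -/
def IsOriginPoint (M : Set R4) (u : R4 → R4) (O : R4) : Prop :=
  O ∉ M ∧ ∀ (γ : ℝ → R4) (I : Set ℝ), IsMaximalIntegralCurveIn M u γ I →
    ∃ a : ℝ, IsGLB I a ∧ Tendsto γ (𝓝[>] a) (𝓝 O) ∧
      ∃ w : R4, HasDerivWithinAt (Function.update γ a O) w (Ici a) a ∧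
        Tendsto (deriv γ) (𝓝[>] a) (𝓝 w)

/-- `F` extends continuously from `M` to `M ∪ {O}`, with value `v` at `O`. For a tensor, `F` is
its matrix of components. -/
def ExtendsContinuouslyTo {α : Type*} [TopologicalSpace α] (M : Set R4) (O : R4)
    (F : R4 → α) (v : α) : Prop :=
  ∃ F' : R4 → α, ContinuousOn F' (insert O M) ∧ EqOn F' F M ∧ F' O = v

/-- The perfect fluid tensor `(ρ₀ + p₀) u_* ⊗ u_* + p₀ g`, where `u_* = g(u, ·)`. -/
def perfectFluid (g : TwoTensor) (u : R4 → R4) (ρ₀ p₀ : ℝ) : TwoTensor := fun p =>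
  (ρ₀ + p₀) • Matrix.vecMulVec (g p *ᵥ u p) (g p *ᵥ u p) + p₀ • g p

/-- The energy-momentum tensor on `M` limits to a perfect fluid `(u, ρ₀, p₀)` at `O`. -/
structure LimitsToPerfectFluid (M : Set R4) (g : TwoTensor) (u : R4 → R4) (O : R4)
    (ρ₀ p₀ : ℝ) : Prop where
  density : ExtendsContinuouslyTo M O (fun p => bil (energyMomentum g p) (u p) (u p)) ρ₀
  pressure : ∀ e : R4 → R4, ContinuousOn e M →
    (∀ p ∈ M, bil (g p) (e p) (e p) = 1 ∧ bil (g p) (u p) (e p) = 0) →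
    ExtendsContinuouslyTo M O (fun p => bil (energyMomentum g p) (e p) (e p)) p₀
  fluid : ExtendsContinuouslyTo M O (fun p => energyMomentum g p - perfectFluid g u ρ₀ p₀ p) 0

/-- The narrow Minkowskian metric `-(ε / (2 - ε)) (dx⁰)² + δ_{ij} dxⁱ dxʲ`. -/
def narrowMinkowski (ε : ℝ) : Matrix (Fin 4) (Fin 4) ℝ :=
  Matrix.diagonal ![-(ε / (2 - ε)), 1, 1, 1]

/-- The coordinate vector field `∂_μ` at `p` of the coordinate system `φ`. -/
def chartVec (φ : OpenPartialHomeomorph R4 R4) (μ : Fin 4) (p : R4) : R4 :=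
  fderiv ℝ φ.symm (φ p) (coordVec μ)

/-- `M` is locally timelike convex near `O` about the curve `γ`, whose parameter interval has
lower end `a`. The coordinate neighborhood is the source of the smooth chart `φ`; the future
`I⁺` of `O` for the narrow Minkowskian metric is computed in the coordinates. -/
def IsLocallyTimelikeConvexAbout (M : Set R4) (g : TwoTensor) (O : R4) (γ : ℝ → R4) (a : ℝ) :
    Prop :=
  ∃ (ε : ℝ) (φ : OpenPartialHomeomorph R4 R4), 0 < ε ∧ ε < 1 ∧
    ContDiffOn ℝ ∞ φ φ.source ∧ ContDiffOn ℝ ∞ φ.symm φ.target ∧ O ∈ φ.source ∧ φ O = 0 ∧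
    (∀ μ ν, bil (g O) (chartVec φ μ O) (chartVec φ ν O) = minkowski μ ν) ∧
    (∀ p ∈ φ.source, ∀ μ ν,
      |bil (g p) (chartVec φ μ p) (chartVec φ ν p) - minkowski μ ν| < ε) ∧
    HasDerivWithinAt (Function.update γ a O) (chartVec φ 0 O) (Ici a) a ∧
    φ.symm '' timelikeFuture (fun _ => narrowMinkowski ε) (fun _ => coordVec 0) 0 φ.target ⊆ M

/-- `(ℝ⁴, g)` is a continuous extension of the `C²` spacetime `(M, g)`, `u` is a unit future
directed timelike vector field on `M`, `O` is an origin point for `u`, `M` is locally timelike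
convex near `O` about some integral curve of `u`, the Ricci tensor of `M` extends continuously to
`M ∪ {O}`, and `(ℝ⁴, g)` is strongly causal at `O`. -/
structure HasGeometricInitialConditions (M : Set R4) (g : TwoTensor) (X u : R4 → R4) (O : R4) :
    Prop where
  spacetime : IsSpacetime 2 M g X
  extension : IsSpacetime 0 univ g X
  proper : M ≠ univ
  field : IsUnitFutureTimelikeField M g X u
  origin : IsOriginPoint M u O
  convex : ∃ (γ : ℝ → R4) (I : Set ℝ) (a : ℝ), IsMaximalIntegralCurveIn M u γ I ∧
    IsGLB I a ∧ IsLocallyTimelikeConvexAbout M g O γ a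
  ricci_extends : ∃ v, ExtendsContinuouslyTo M O (ricci g) v
  stronglyCausal : StronglyCausalAt g X O

/-! ### The examples -/

/-- The radial coordinate `r = √(x² + y² + z²)`. -/
def radius (p : R4) : ℝ := Real.sqrt (p 1 ^ 2 + p 2 ^ 2 + p 3 ^ 2)

/-- The derivative `f'` of a function on `[0, ∞)`, one-sided at `0`. -/
def deriv₀ (f : ℝ → ℝ) (r : ℝ) : ℝ := derivWithin f (Ici 0) r

/-- `ζ(t, r) = t² / 2 - ∫₀^r f / f'`. -/
def zeta (f : ℝ → ℝ) (p : R4) : ℝ :=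
  p 0 ^ 2 / 2 - ∫ s in (0 : ℝ)..radius p, f s / deriv₀ f s

/-- The metric `g = e^{2Φ(ζ)} η`. -/
def exampleMetric (f Φ : ℝ → ℝ) : TwoTensor := fun p =>
  Real.exp (2 * Φ (zeta f p)) • minkowski

/-- The vector field `u = -∇ζ / |∇ζ|`. -/
def comovingField (f Φ : ℝ → ℝ) (p : R4) : R4 :=
  -((vecNorm (exampleMetric f Φ) p (metricGradient (exampleMetric f Φ) (zeta f) p))⁻¹ •
    metricGradient (exampleMetric f Φ) (zeta f) p)

/-- The region `t > (1 + ε) f(r)`. -/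
def region (f : ℝ → ℝ) (ε : ℝ) : Set R4 := {p | (1 + ε) * f (radius p) < p 0}

/-- The time orientation `∂_t`. -/
def timeOrientation : R4 → R4 := fun _ => coordVec 0

end

/-! ### Bilinear forms in components -/

/-! The metric is `e^{2φ} η` with `φ = Φ ∘ ζ`, so its light cones are those of Minkowski space;
strong causality follows because a causal curve moves each coordinate by at most the elapsed `t`.

Regularity: let `k` be the odd C¹ extension of `f / f'`. The components of `dζ` are, up to sign, `t`
and `(k(r)/r) xⁱ`, and the latter are C¹ even where `r = 0` (`contDiff_radialField`). Hence `ζ` and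
`φ` are C², and the Ricci tensor and `T` are continuous on all of `ℝ⁴`.

Curvature at the origin: `f(0) = 0` and `f'(0) = 1` give `k'(0) = 1`, so at the origin `dζ = 0` and
`Hess ζ = -η`. Thus `dφ = 0`, `Hess φ = -Φ'(0) η`, and the curvature formulas at a critical point
make `Ric` and `T` pure multiples of `g`, with `T = -ρ g`.

Flow lines: `u` is a positive multiple of `t ∂_t + k(r) ∂_r`. Along it both `t` and `f(r)` grow at
the same logarithmic rate, because `f' · (f/f') = f`; so the direction `x/r` and the ratio `f(r)/t`
are conserved, and every integral curve is a piece of a curve `f(r) = |w| t` (`integralCurve_eq`).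
These curves pass through the origin with a velocity, and since `f' ≥ 1` and `|w| < 1` their proper
time is a C¹ parameter up to and across `t = 0`.

Fluid limit: on `M_ε` the cone condition keeps `u` uniformly away from the light cone, so the
components of `u` and of every unit `e ⟂ u` are bounded near the origin. As `T + ρ g` tends to `0`
there, so do its values on these vectors. Uniqueness is read off on the `t`-axis. -/

theorem bil_smul_left (c : ℝ) (A : Matrix (Fin 4) (Fin 4) ℝ) (v w : R4) :
    bil (c • A) v w = c * bil A v w := by
  simp [bil, Matrix.smul_mulVec, dotProduct_smul]

theorem bil_diagonal (d v w : R4) :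
    bil (Matrix.diagonal d) v w = ∑ i, d i * (v i * w i) := by
  simp only [bil, dotProduct, Matrix.mulVec_diagonal]
  exact Finset.sum_congr rfl fun i _ => by ring

theorem bil_minkowski (v w : R4) :
    bil minkowski v w = -(v 0 * w 0) + v 1 * w 1 + v 2 * w 2 + v 3 * w 3 := by
  rw [minkowski, bil_diagonal]
  simp [Fin.sum_univ_four]

theorem bil_narrowMinkowski (δ : ℝ) (v w : R4) :
    bil (narrowMinkowski δ) v w
      = -(δ / (2 - δ)) * (v 0 * w 0) + v 1 * w 1 + v 2 * w 2 + v 3 * w 3 := by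
  rw [narrowMinkowski, bil_diagonal]
  simp [Fin.sum_univ_four]

theorem coordVec_zero_apply_zero : coordVec 0 0 = 1 := by simp [coordVec]

theorem bil_minkowski_coordVec_zero (v : R4) : bil minkowski (coordVec 0) v = -v 0 := by
  simp [bil_minkowski, coordVec]

/-- The conformally flat metric `e^{2φ} η`. -/
noncomputable def conformalMetric (φ : R4 → ℝ) : TwoTensor := fun p =>
  Real.exp (2 * φ p) • minkowski

theorem bil_conformalMetric (φ : R4 → ℝ) (p v w : R4) :
    bil (conformalMetric φ p) v w = Real.exp (2 * φ p) * bil minkowski v w :=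
  bil_smul_left _ _ _ _

/-! ### Growth of linear functionals along Lipschitz curves -/

theorem mul_sub_le_of_le_deriv {γ : ℝ → R4} {a b c : ℝ} {K : ℝ≥0} (ℓ : R4 →L[ℝ] ℝ) (hab : a ≤ b)
    (hγ : LipschitzOnWith K γ (Icc a b))
    (hd : ∀ᵐ s ∂(volume.restrict (Icc a b)), deriv γ s ≠ 0 ∧ c ≤ ℓ (deriv γ s)) :
    c * (b - a) ≤ ℓ (γ b) - ℓ (γ a) := by
  have hL : LipschitzOnWith (‖ℓ‖₊ * K) (fun s => ℓ (γ s)) (uIcc a b) := by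
    rw [uIcc_of_le hab]
    exact ℓ.lipschitz.comp_lipschitzOnWith hγ
  have hac := hL.absolutelyContinuousOnInterval
  have hint := hac.intervalIntegrable_deriv
  rw [← hac.integral_deriv_eq_sub]
  have : c * (b - a) = ∫ _ in a..b, c := by simp [mul_comm]
  rw [this]
  refine intervalIntegral.integral_mono_ae_restrict hab (by simp) hint ?_
  filter_upwards [hd] with s hs
  -- `deriv` takes the value `0` where `γ` is not differentiable, so a nonzero value certifies
  -- differentiability.
  have h1 : DifferentiableAt ℝ γ s := by
    by_contra h
    exact hs.1 (deriv_zero_of_not_differentiableAt h)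
  have h2 : HasDerivAt (fun s => ℓ (γ s)) (ℓ (deriv γ s)) s :=
    ℓ.hasFDerivAt.comp_hasDerivAt s h1.hasDerivAt
  change c ≤ deriv (fun s => ℓ (γ s)) s
  rw [h2.deriv]
  exact hs.2

/-- Apply the preceding bound with `c = 0` to the functionals `κ dx⁰ ± dxⁱ`, which are nondecreasing
along the curve. -/
theorem coord_monotone_of_le_deriv {γ : ℝ → R4} {a b κ : ℝ} {K : ℝ≥0} (hab : a ≤ b)
    (hγ : LipschitzOnWith K γ (Icc a b)) (i : Fin 4)
    (hd : ∀ᵐ s ∂(volume.restrict (Icc a b)), deriv γ s ≠ 0 ∧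
      |deriv γ s i| ≤ κ * deriv γ s 0) :
    |γ b i - γ a i| ≤ κ * (γ b 0 - γ a 0) := by
  have h1 := mul_sub_le_of_le_deriv (c := 0)
    (κ • ContinuousLinearMap.proj (R := ℝ) (φ := fun _ : Fin 4 => ℝ) 0
      - ContinuousLinearMap.proj i) hab hγ (by
        filter_upwards [hd] with s hs
        refine ⟨hs.1, ?_⟩
        have := (abs_le.1 hs.2).2
        simp; linarith)
  have h2 := mul_sub_le_of_le_deriv (c := 0)
    (κ • ContinuousLinearMap.proj (R := ℝ) (φ := fun _ : Fin 4 => ℝ) 0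
      + ContinuousLinearMap.proj i) hab hγ (by
        filter_upwards [hd] with s hs
        refine ⟨hs.1, ?_⟩
        have := (abs_le.1 hs.2).1
        simp; linarith)
  simp at h1 h2
  rw [abs_le]
  constructor <;> linarith

/-! ### Strong causality -/

theorem IsFutureCausalCurve.mono {g : TwoTensor} {X : R4 → R4} {γ : ℝ → R4} {a b a' b' : ℝ}
    (h : IsFutureCausalCurve g X γ a b) (ha : a ≤ a') (hb : b' ≤ b) :
    IsFutureCausalCurve g X γ a' b' := by
  obtain ⟨⟨K, hK⟩, hd⟩ := h
  exact ⟨⟨K, hK.mono (Icc_subset_Icc ha hb)⟩,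
    ae_restrict_of_ae_restrict_of_subset (Icc_subset_Icc ha hb) hd⟩

theorem abs_coord_sub_le_of_isFutureCausalCurve {φ : R4 → ℝ} {γ : ℝ → R4} {a b : ℝ} (hab : a ≤ b)
    (h : IsFutureCausalCurve (conformalMetric φ) timeOrientation γ a b) (i : Fin 4) :
    |γ b i - γ a i| ≤ γ b 0 - γ a 0 := by
  obtain ⟨⟨K, hK⟩, hd⟩ := h
  have := coord_monotone_of_le_deriv (κ := 1) hab hK i (by
    filter_upwards [hd] with s ⟨h0, h1, h2⟩
    refine ⟨h0, ?_⟩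
    rw [bil_conformalMetric] at h1 h2
    have e := Real.exp_pos (2 * φ (γ s))
    rw [timeOrientation, bil_minkowski_coordVec_zero] at h2
    have h3 : 0 < deriv γ s 0 := by
      by_contra hn
      push Not at hn
      nlinarith
    have h4 : bil minkowski (deriv γ s) (deriv γ s) ≤ 0 := by
      by_contra hn
      push Not at hn
      nlinarith [mul_pos e hn]
    rw [bil_minkowski] at h4
    rw [one_mul]
    apply abs_le_of_sq_le_sq _ h3.le
    fin_cases i <;> simp only [Fin.zero_eta, Fin.mk_one, Fin.reduceFinMk] <;>
    nlinarith [sq_nonneg (deriv γ s 1), sq_nonneg (deriv γ s 2), sq_nonneg (deriv γ s 3)])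
  linarith

theorem stronglyCausalAt_conformalMetric (φ : R4 → ℝ) :
    StronglyCausalAt (conformalMetric φ) timeOrientation 0 := by
  intro U hU
  obtain ⟨r, hr, hrU⟩ := Metric.mem_nhds_iff.1 hU
  -- `t` increases along the curve and its endpoints satisfy `|t| < r/4`, so the elapsed `t` is
  -- below `r/2` and no coordinate leaves `(-3r/4, 3r/4)`.
  refine ⟨Metric.ball 0 (r / 4), Metric.ball_mem_nhds _ (by positivity),
    (Metric.ball_subset_ball (by linarith)).trans hrU, ?_⟩
  intro γ a b hab hγ ha hb s hs
  apply hrU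
  rw [mem_ball_zero_iff, pi_norm_lt_iff hr]
  intro i
  rw [mem_ball_zero_iff, pi_norm_lt_iff (by positivity)] at ha hb
  have h1 := abs_coord_sub_le_of_isFutureCausalCurve hs.1 (hγ.mono le_rfl hs.2) i
  have h2 := (abs_nonneg _).trans
    (abs_coord_sub_le_of_isFutureCausalCurve hs.2 (hγ.mono hs.1 le_rfl) 0)
  have h3 := abs_lt.1 (ha 0)
  have h4 := abs_lt.1 (hb 0)
  have h5 := abs_lt.1 (ha i)
  have h6 := abs_le.1 h1
  rw [Real.norm_eq_abs, abs_lt]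
  constructor <;> linarith

/-! ### Timelike futures for the narrow Minkowskian metric -/

/-- The narrow cone has slope squared `δ / (2 - δ) ≤ δ ≤ κ²`, which bounds the spatial displacement
by `κ` times the time elapsed. The uniform bound in the definition of a timelike curve forces
`dx⁰/ds ≥ √ε`, hence strict positivity of the time coordinate. -/
theorem mem_timelikeFuture_narrowMinkowski {δ κ : ℝ} (hδ : 0 < δ) (hδ1 : δ < 1) (hκ : 0 ≤ κ)
    (hδκ : δ ≤ κ ^ 2) {U : Set R4} {q : R4}
    (hq : q ∈ timelikeFuture (fun _ => narrowMinkowski δ) (fun _ => coordVec 0) 0 U) :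
    q ∈ U ∧ 0 < q 0 ∧ ∀ i : Fin 4, i ≠ 0 → |q i| ≤ κ * q 0 := by
  obtain ⟨γ, a, b, hab, ⟨⟨⟨K, hK⟩, hd⟩, ε, hε, hε'⟩, hU, ha, hb⟩ := hq
  have hm : 0 < δ / (2 - δ) := div_pos hδ (by linarith)
  have hmδ : δ / (2 - δ) ≤ κ ^ 2 := by
    rw [div_le_iff₀ (by linarith)]
    nlinarith
  have key : ∀ᵐ s ∂(volume.restrict (Icc a b)), deriv γ s ≠ 0 ∧ 0 < deriv γ s 0 ∧
      deriv γ s 1 ^ 2 + deriv γ s 2 ^ 2 + deriv γ s 3 ^ 2 + ε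
        ≤ δ / (2 - δ) * deriv γ s 0 ^ 2 := by
    filter_upwards [hd, hε'] with s ⟨h0, h1, h2⟩ h3
    rw [bil_narrowMinkowski] at h2 h3
    simp [coordVec] at h2
    exact ⟨h0, by by_contra hn; push Not at hn; nlinarith, by nlinarith⟩
  refine ⟨hb ▸ hU b ⟨hab.le, le_rfl⟩, ?_, fun i hi => ?_⟩
  · have := mul_sub_le_of_le_deriv (c := Real.sqrt ε)
      (ContinuousLinearMap.proj (R := ℝ) (φ := fun _ : Fin 4 => ℝ) 0) hab.le hK (by
        filter_upwards [key] with s ⟨h0, h1, h2⟩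
        refine ⟨h0, Real.sqrt_le_iff.2 ⟨h1.le, ?_⟩⟩
        have hm1 : δ / (2 - δ) ≤ 1 := by
          rw [div_le_iff₀ (by linarith)]
          linarith
        simp only [ContinuousLinearMap.proj_apply]
        nlinarith [sq_nonneg (deriv γ s 1), sq_nonneg (deriv γ s 2), sq_nonneg (deriv γ s 3),
          sq_nonneg (deriv γ s 0)])
    simp only [ContinuousLinearMap.proj_apply, ha, hb, Pi.zero_apply, sub_zero] at this
    exact (mul_pos (Real.sqrt_pos.2 hε) (sub_pos.2 hab)).trans_le this
  · have := coord_monotone_of_le_deriv (κ := κ) hab.le hK i (by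
      filter_upwards [key] with s ⟨h0, h1, h2⟩
      refine ⟨h0, abs_le_of_sq_le_sq ?_ (by positivity)⟩
      have : deriv γ s i ^ 2 ≤ δ / (2 - δ) * deriv γ s 0 ^ 2 := by
        fin_cases i
        · simp at hi
        all_goals
          simp only [Fin.mk_one, Fin.reduceFinMk]
          nlinarith [sq_nonneg (deriv γ s 1), sq_nonneg (deriv γ s 2), sq_nonneg (deriv γ s 3)]
      rw [mul_pow]
      exact this.trans (mul_le_mul_of_nonneg_right hmδ (sq_nonneg _)))
    simpa [ha, hb] using this

/-! ### The radial coordinate -/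

theorem radius_nonneg (p : R4) : 0 ≤ radius p := Real.sqrt_nonneg _

theorem radius_sq (p : R4) : radius p ^ 2 = p 1 ^ 2 + p 2 ^ 2 + p 3 ^ 2 :=
  Real.sq_sqrt (by positivity)

theorem continuous_radius : Continuous radius := by
  unfold radius
  fun_prop

theorem radius_zero : radius 0 = 0 := by simp [radius]

theorem abs_apply_le_radius (p : R4) {i : Fin 4} (hi : i ≠ 0) : |p i| ≤ radius p := by
  apply abs_le_of_sq_le_sq _ (radius_nonneg p)
  rw [radius_sq]
  fin_cases i
  · simp at hi
  all_goals
    simp only [Fin.mk_one, Fin.reduceFinMk]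
    nlinarith [sq_nonneg (p 1), sq_nonneg (p 2), sq_nonneg (p 3)]

theorem apply_eq_zero_of_radius_eq_zero {p : R4} (hp : radius p = 0) {i : Fin 4} (hi : i ≠ 0) :
    p i = 0 :=
  abs_nonpos_iff.1 ((abs_apply_le_radius p hi).trans_eq hp)

theorem radius_le_two_mul_norm_sub {p : R4} (hp : radius p = 0) (q : R4) :
    radius q ≤ 2 * ‖q - p‖ := by
  refine Real.sqrt_le_iff.2 ⟨by positivity, ?_⟩
  have h : ∀ i : Fin 4, i ≠ 0 → q i ^ 2 ≤ ‖q - p‖ ^ 2 := fun i hi => by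
    rw [← sq_abs]
    refine pow_le_pow_left₀ (abs_nonneg _) ?_ 2
    simpa [apply_eq_zero_of_radius_eq_zero hp hi] using norm_le_pi_norm (q - p) i
  nlinarith [h 1 (by simp), h 2 (by simp), h 3 (by simp)]

/-- The coordinate one-form `dx^i`. -/
noncomputable abbrev coordForm (i : Fin 4) : R4 →L[ℝ] ℝ := ContinuousLinearMap.proj i

/-- The one-form `x dx + y dy + z dz`. -/
noncomputable def spatialForm (p : R4) : R4 →L[ℝ] ℝ :=
  p 1 • coordForm 1 + p 2 • coordForm 2 + p 3 • coordForm 3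

theorem spatialForm_apply (p v : R4) :
    spatialForm p v = p 1 * v 1 + p 2 * v 2 + p 3 * v 3 := by
  simp [spatialForm]

theorem spatialForm_eq_zero {p : R4} (hp : radius p = 0) : spatialForm p = 0 := by
  simp [spatialForm, apply_eq_zero_of_radius_eq_zero hp]

theorem hasFDerivAt_coord (i : Fin 4) (p : R4) :
    HasFDerivAt (fun q : R4 => q i) (coordForm i) p :=
  (coordForm i).hasFDerivAt

theorem hasFDerivAt_radius {p : R4} (hp : radius p ≠ 0) :
    HasFDerivAt radius ((radius p)⁻¹ • spatialForm p) p := by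
  have h0 : p 1 ^ 2 + p 2 ^ 2 + p 3 ^ 2 ≠ 0 := by
    rw [← radius_sq]; positivity
  have h := ((((hasFDerivAt_coord 1 p).pow 2).add ((hasFDerivAt_coord 2 p).pow 2)).add
    ((hasFDerivAt_coord 3 p).pow 2)).sqrt h0
  refine h.congr_fderiv ?_
  ext v
  change _ = ((radius p)⁻¹ • spatialForm p) v
  simp only [smul_apply, spatialForm_apply, smul_eq_mul]
  simp [radius]
  field_simp

/-! ### Radial vector fields -/

/-- `k` is a `C¹` function on `ℝ` with derivative `k'` that vanishes at `0`. -/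
structure IsRadialProfile (k k' : ℝ → ℝ) : Prop where
  hasDerivAt : ∀ r, HasDerivAt k (k' r) r
  continuous_deriv : Continuous k'
  map_zero : k 0 = 0

/-- The components of the vector field `k(r) ∂_r`. -/
noncomputable def radialField (k : ℝ → ℝ) (i : Fin 4) (p : R4) : ℝ :=
  dslope k 0 (radius p) * p i

/-- The differential of `radialField k i`, where `k'` is the derivative of `k`. -/
noncomputable def radialFieldDeriv (k k' : ℝ → ℝ) (i : Fin 4) (p : R4) : R4 →L[ℝ] ℝ :=
  dslope k 0 (radius p) • coordForm i
    + (p i * ((k' (radius p) - dslope k 0 (radius p)) / radius p ^ 2)) • spatialForm p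

/-- For a purely radial `v` the two `dslope` contributions cancel and only `k'` survives. This
yields the conservation law along flow lines. -/
theorem radialFieldDeriv_apply {k k' : ℝ → ℝ} {i : Fin 4} (hi : i ≠ 0) {p v : R4} {q : ℝ}
    (hv : ∀ j : Fin 4, j ≠ 0 → v j = q * p j) :
    radialFieldDeriv k k' i p v = q * k' (radius p) * p i := by
  have h : spatialForm p v = q * radius p ^ 2 := by
    rw [spatialForm_apply, hv 1 (by simp), hv 2 (by simp), hv 3 (by simp), radius_sq]
    ring
  simp only [radialFieldDeriv, add_apply, smul_apply,
    ContinuousLinearMap.proj_apply, smul_eq_mul, h, hv i hi]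
  rcases eq_or_ne (radius p) 0 with hp | hp
  · simp [apply_eq_zero_of_radius_eq_zero hp hi]
  · field_simp
    ring

namespace IsRadialProfile

variable {k k' : ℝ → ℝ} (hk : IsRadialProfile k k')
include hk

theorem continuous : Continuous k :=
  continuous_iff_continuousAt.2 fun r => (hk.hasDerivAt r).continuousAt

theorem dslope_zero : dslope k 0 0 = k' 0 := by
  rw [dslope_same, (hk.hasDerivAt 0).deriv]

theorem dslope_of_ne {r : ℝ} (hr : r ≠ 0) : dslope k 0 r = k r / r := by
  rw [_root_.dslope_of_ne _ hr, slope_def_field, hk.map_zero, sub_zero, sub_zero]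

theorem dslope_mul_self (r : ℝ) : dslope k 0 r * r = k r := by
  rcases eq_or_ne r 0 with rfl | hr
  · simp [hk.map_zero]
  · rw [hk.dslope_of_ne hr, div_mul_cancel₀ _ hr]

theorem continuous_dslope : Continuous (dslope k 0) := by
  refine continuous_iff_continuousAt.2 fun r => ?_
  rcases eq_or_ne r 0 with rfl | hr
  · exact continuousAt_dslope_same.2 (hk.hasDerivAt 0).differentiableAt
  · exact (continuousAt_dslope_of_ne hr).2 hk.continuous.continuousAt

theorem hasDerivAt_dslope {r : ℝ} (hr : r ≠ 0) :
    HasDerivAt (dslope k 0) ((k' r - dslope k 0 r) / r) r := by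
  have h := (hk.hasDerivAt r).div (hasDerivAt_id r) hr
  have h' : HasDerivAt (dslope k 0) ((k' r * id r - k r * 1) / id r ^ 2) r := by
    refine h.congr_of_eventuallyEq ?_
    filter_upwards [eventually_ne_nhds hr] with s hs
    simp [hk.dslope_of_ne hs]
  convert! h' using 1
  rw [hk.dslope_of_ne hr]
  simp only [id]
  field_simp

/-- Where `r = 0` the factor `p i` vanishes, so continuity of `k(r)/r` already gives
differentiability of the product; elsewhere the product rule applies. -/
theorem hasFDerivAt_radialField {i : Fin 4} (hi : i ≠ 0) (p : R4) :
    HasFDerivAt (radialField k i) (radialFieldDeriv k k' i p) p := by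
  rcases eq_or_ne (radius p) 0 with hp | hp
  · have hpi := apply_eq_zero_of_radius_eq_zero hp hi
    rw [hasFDerivAt_iff_isLittleO]
    have h1 : (fun q => dslope k 0 (radius q) - dslope k 0 (radius p)) =o[𝓝 p]
        fun _ => (1 : ℝ) := by
      rw [Asymptotics.isLittleO_one_iff]
      have := (hk.continuous_dslope.comp continuous_radius).tendsto p
      simpa using this.sub_const (dslope k 0 (radius p))
    have h2 : (fun q : R4 => q i) =O[𝓝 p] fun q => q - p := by
      refine Asymptotics.IsBigO.of_bound 1 (Eventually.of_forall fun q => ?_)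
      simpa [hpi] using norm_le_pi_norm (q - p) i
    have h3 := h1.mul_isBigO h2.norm_right
    simp only [one_mul] at h3
    refine h3.of_norm_right.congr_left fun q => ?_
    simp [radialField, radialFieldDeriv, hpi]
    ring
  · have h := ((hk.hasDerivAt_dslope hp).comp_hasFDerivAt p (hasFDerivAt_radius hp)).mul
      (hasFDerivAt_coord i p)
    refine h.congr_fderiv ?_
    ext v
    simp [radialFieldDeriv]
    field_simp

/-- The only singular coefficients are `xⁱ xʲ (k'(r) - k(r)/r) / r²`. Since `|xⁱ xʲ| ≤ r²` they are
bounded by `|k'(r) - k(r)/r|`, which tends to `0` as `r → 0`. -/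
theorem continuous_radialFieldDeriv {i : Fin 4} (hi : i ≠ 0) :
    Continuous (radialFieldDeriv k k' i) := by
  have hQ : Continuous fun p => dslope k 0 (radius p) :=
    hk.continuous_dslope.comp continuous_radius
  have hD : Continuous fun p => k' (radius p) - dslope k 0 (radius p) :=
    (hk.continuous_deriv.comp continuous_radius).sub hQ
  have key : ∀ j : Fin 4, j ≠ 0 → Continuous fun p : R4 =>
      p i * ((k' (radius p) - dslope k 0 (radius p)) / radius p ^ 2) * p j := by
    intro j hj
    refine continuous_iff_continuousAt.2 fun p => ?_
    rcases eq_or_ne (radius p) 0 with hp | hp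
    · have h0 : Tendsto (fun q => |k' (radius q) - dslope k 0 (radius q)|) (𝓝 p) (𝓝 0) := by
        have := hD.abs.tendsto p
        rwa [hp, hk.dslope_zero, sub_self, abs_zero] at this
      rw [ContinuousAt, apply_eq_zero_of_radius_eq_zero hp hj, mul_zero]
      refine squeeze_zero_norm (fun q => ?_) h0
      rcases eq_or_ne (radius q) 0 with hq | hq
      · simp [apply_eq_zero_of_radius_eq_zero hq hj]
      · have hq' : 0 < radius q := (radius_nonneg q).lt_of_ne' hq
        have : |q i| * |q j| ≤ radius q ^ 2 := by
          rw [sq]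
          exact mul_le_mul (abs_apply_le_radius q hi) (abs_apply_le_radius q hj) (abs_nonneg _)
            (radius_nonneg q)
        rw [Real.norm_eq_abs, abs_mul, abs_mul, abs_div, abs_of_pos (pow_pos hq' 2)]
        rw [mul_right_comm, ← mul_div_assoc, div_le_iff₀ (pow_pos hq' 2), mul_comm]
        exact mul_le_mul_of_nonneg_left this (abs_nonneg _)
    · have h1 : ContinuousAt (fun p => (k' (radius p) - dslope k 0 (radius p)) / radius p ^ 2) p :=
        hD.continuousAt.div (continuous_radius.pow 2).continuousAt (pow_ne_zero 2 hp)
      exact ((continuous_apply i).continuousAt.mul h1).mul (continuous_apply j).continuousAt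
  unfold radialFieldDeriv spatialForm
  simp only [smul_add, smul_smul]
  exact (hQ.smul continuous_const).add ((((key 1 (by simp)).smul continuous_const).add
    ((key 2 (by simp)).smul continuous_const)).add ((key 3 (by simp)).smul continuous_const))

theorem contDiff_radialField {i : Fin 4} (hi : i ≠ 0) : ContDiff ℝ 1 (radialField k i) :=
  contDiff_one_iff_hasFDerivAt.2 ⟨_, hk.continuous_radialFieldDeriv hi,
    hk.hasFDerivAt_radialField hi⟩

theorem partialD_radialField_zero {i : Fin 4} (hi : i ≠ 0) (j : Fin 4) :
    partialD j (radialField k i) 0 = if j = i then k' 0 else 0 := by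
  rw [partialD, (hk.hasFDerivAt_radialField hi 0).fderiv]
  simp only [radialFieldDeriv, radius_zero, hk.dslope_zero]
  simp [coordVec, Pi.single_apply, eq_comm]

/-! ### The potential `t² / 2 - ∫₀^r k` -/

/-- Where `r = 0` the radius is not differentiable, but `∫₀^r k = o(r)` because `k 0 = 0`, and `r`
is Lipschitz, so the integral has zero differential there. -/
theorem hasFDerivAt_potential (p : R4) :
    HasFDerivAt (fun q : R4 => q 0 ^ 2 / 2 - ∫ s in (0 : ℝ)..radius q, k s)
      (p 0 • coordForm 0 - (radialField k 1 p • coordForm 1 + radialField k 2 p • coordForm 2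
        + radialField k 3 p • coordForm 3)) p := by
  have hH : ∀ r, HasDerivAt (fun r => ∫ s in (0 : ℝ)..r, k s) (k r) r := fun r =>
    intervalIntegral.integral_hasDerivAt_right (hk.continuous.intervalIntegrable _ _)
      (hk.continuous.stronglyMeasurableAtFilter _ _) hk.continuous.continuousAt
  have hr : HasFDerivAt (fun q => ∫ s in (0 : ℝ)..radius q, k s)
      (dslope k 0 (radius p) • spatialForm p) p := by
    rcases eq_or_ne (radius p) 0 with hp | hp
    · rw [spatialForm_eq_zero hp, smul_zero, hasFDerivAt_iff_isLittleO]
      have h1 := (hasDerivAt_iff_isLittleO.1 (hH 0)).comp_tendsto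
        (k := radius) (l' := 𝓝 p) (by simpa [hp] using continuous_radius.tendsto p)
      have h2 : radius =O[𝓝 p] fun q => q - p :=
        Asymptotics.IsBigO.of_bound 2 (Eventually.of_forall fun q => by
          rw [Real.norm_eq_abs, abs_of_nonneg (radius_nonneg q)]
          exact radius_le_two_mul_norm_sub hp q)
      simp only [intervalIntegral.integral_same, sub_zero, hk.map_zero, smul_zero] at h1
      refine (h1.trans_isBigO h2).congr_left fun q => ?_
      simp [hp]
    · refine ((hH (radius p)).comp_hasFDerivAt p (hasFDerivAt_radius hp)).congr_fderiv ?_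
      rw [smul_smul, hk.dslope_of_ne hp, div_eq_mul_inv]
  have ht : HasFDerivAt (fun q : R4 => q 0 ^ 2 / 2) (p 0 • coordForm 0) p := by
    have := ((hasFDerivAt_coord 0 p).pow 2).mul_const (2 : ℝ)⁻¹
    refine (this.congr_fderiv ?_)
    ext v
    simp
    ring
  refine (ht.sub hr).congr_fderiv ?_
  ext v
  simp [radialField, spatialForm]
  ring

theorem contDiff_potential :
    ContDiff ℝ 2 fun q : R4 => q 0 ^ 2 / 2 - ∫ s in (0 : ℝ)..radius q, k s := by
  refine (contDiff_succ_iff_hasFDerivAt (n := 1)).2 ⟨_, ?_, hk.hasFDerivAt_potential⟩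
  have h1 := hk.contDiff_radialField (i := 1) (by simp)
  have h2 := hk.contDiff_radialField (i := 2) (by simp)
  have h3 := hk.contDiff_radialField (i := 3) (by simp)
  exact ((contDiff_apply ℝ ℝ 0).smul contDiff_const).sub (((h1.smul contDiff_const).add
    (h2.smul contDiff_const)).add (h3.smul contDiff_const))

end IsRadialProfile

/-! ### Curvature of conformally flat metrics -/

theorem minkowski_mul_self : minkowski * minkowski = 1 := by
  rw [minkowski, Matrix.diagonal_mul_diagonal, ← Matrix.diagonal_one]
  congr 1
  ext i
  fin_cases i <;> simp

theorem inv_conformalMetric (φ : R4 → ℝ) (p : R4) :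
    (conformalMetric φ p)⁻¹ = Real.exp (-(2 * φ p)) • minkowski := by
  apply Matrix.inv_eq_right_inv
  rw [conformalMetric, Matrix.smul_mul, Matrix.mul_smul, minkowski_mul_self, smul_smul,
    ← Real.exp_add]
  simp

theorem isLorentzian_conformalMetric (φ : R4 → ℝ) (p : R4) :
    IsLorentzian (conformalMetric φ p) := by
  refine ⟨Real.exp (-φ p) • 1, ?_, ?_⟩
  · simp
  · rw [conformalMetric, Matrix.transpose_smul, Matrix.transpose_one]
    simp only [Matrix.smul_mul, Matrix.mul_smul, one_mul, mul_one, smul_smul, ← Real.exp_add]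
    rw [show -φ p + (2 * φ p + -φ p) = 0 by ring, Real.exp_zero, one_smul]

theorem conformalMetric_apply (φ : R4 → ℝ) (p : R4) (i j : Fin 4) :
    conformalMetric φ p i j = Real.exp (2 * φ p) * minkowski i j := rfl

theorem contDiff_conformalMetric {φ : R4 → ℝ} {n : WithTop ℕ∞} (hφ : ContDiff ℝ n φ)
    (i j : Fin 4) : ContDiff ℝ n fun p => conformalMetric φ p i j := by
  simp only [conformalMetric_apply]
  exact (contDiff_const.mul hφ).exp.mul contDiff_const

theorem partialD_conformalMetric {φ : R4 → ℝ} {p : R4} (hφ : DifferentiableAt ℝ φ p)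
    (m i j : Fin 4) :
    partialD m (fun q => conformalMetric φ q i j) p
      = Real.exp (2 * φ p) * (2 * partialD m φ p * minkowski i j) := by
  simp only [conformalMetric_apply, partialD]
  rw [((hφ.hasFDerivAt.const_mul 2).exp.mul_const _).fderiv]
  simp
  ring

/-- The factors `e^{±2φ}` cancel, leaving an expression linear in `dφ`. A C² exponent therefore has
C¹ Christoffel symbols, and continuous curvature. -/
theorem christoffel_conformalMetric {φ : R4 → ℝ} (hφ : Differentiable ℝ φ) (k i j : Fin 4) :
    christoffel (conformalMetric φ) k i j = fun p => ∑ l, minkowski k l *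
      (partialD i φ p * minkowski j l + partialD j φ p * minkowski i l
        - partialD l φ p * minkowski i j) := by
  funext p
  rw [christoffel, Finset.mul_sum]
  refine Finset.sum_congr rfl fun l _ => ?_
  rw [inv_conformalMetric, partialD_conformalMetric (hφ p), partialD_conformalMetric (hφ p),
    partialD_conformalMetric (hφ p), Matrix.smul_apply, smul_eq_mul, Real.exp_neg]
  have := (Real.exp_pos (2 * φ p)).ne'
  field_simp

theorem contDiff_partialD {φ : R4 → ℝ} {n : WithTop ℕ∞} (hφ : ContDiff ℝ (n + 1) φ) (i : Fin 4) :
    ContDiff ℝ n (partialD i φ) :=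
  (hφ.fderiv_right le_rfl).clm_apply contDiff_const

theorem contDiff_christoffel_conformalMetric {φ : R4 → ℝ} (hφ : ContDiff ℝ 2 φ) (k i j : Fin 4) :
    ContDiff ℝ 1 (christoffel (conformalMetric φ) k i j) := by
  rw [christoffel_conformalMetric (hφ.differentiable (by simp))]
  have h : ∀ i, ContDiff ℝ 1 (partialD i φ) := contDiff_partialD (by simpa [one_add_one_eq_two])
  exact ContDiff.sum fun l _ => contDiff_const.mul ((((h i).mul contDiff_const).add
    ((h j).mul contDiff_const)).sub ((h l).mul contDiff_const))

theorem continuous_partialD {F : R4 → ℝ} (hF : ContDiff ℝ 1 F) (i : Fin 4) :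
    Continuous (partialD i F) :=
  (contDiff_partialD (n := 0) (by simpa) i).continuous

theorem continuous_ricci_conformalMetric {φ : R4 → ℝ} (hφ : ContDiff ℝ 2 φ) :
    Continuous (ricci (conformalMetric φ)) := by
  have h := contDiff_christoffel_conformalMetric hφ
  have h0 : ∀ k i j, Continuous (christoffel (conformalMetric φ) k i j) := fun k i j =>
    (h k i j).continuous
  have h1 : ∀ m k i j, Continuous (partialD m (christoffel (conformalMetric φ) k i j)) :=
    fun m k i j => continuous_partialD (h k i j) m
  refine continuous_matrix fun i j => ?_
  simp only [ricci, Matrix.of_apply]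
  exact (((continuous_finsetSum _ fun k _ => h1 _ _ _ _).sub
    (continuous_finsetSum _ fun k _ => h1 _ _ _ _)).add
    (continuous_finsetSum _ fun k _ => continuous_finsetSum _ fun l _ =>
      (h0 _ _ _).mul (h0 _ _ _))).sub
    (continuous_finsetSum _ fun k _ => continuous_finsetSum _ fun l _ =>
      (h0 _ _ _).mul (h0 _ _ _))

theorem partialD_christoffel_conformalMetric {φ : R4 → ℝ} (hφ : ContDiff ℝ 2 φ)
    (m k i j : Fin 4) (p : R4) :
    partialD m (christoffel (conformalMetric φ) k i j) p = ∑ l, minkowski k l *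
      (partialD m (partialD i φ) p * minkowski j l + partialD m (partialD j φ) p * minkowski i l
        - partialD m (partialD l φ) p * minkowski i j) := by
  have h : ∀ i, HasFDerivAt (partialD i φ) (fderiv ℝ (partialD i φ) p) p := fun i =>
    ((contDiff_partialD (n := 1) (by simpa [one_add_one_eq_two]) i).differentiable
      (by simp) p).hasFDerivAt
  rw [christoffel_conformalMetric (hφ.differentiable (by simp)), partialD,
    (HasFDerivAt.fun_sum fun l _ => ((((h i).mul_const _).fun_add ((h j).mul_const _)).fun_sub
      ((h l).mul_const _)).const_mul (minkowski k l)).fderiv]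
  simp only [sum_apply, smul_apply, sub_apply, add_apply, smul_eq_mul, partialD]
  exact Finset.sum_congr rfl fun l _ => by ring

/-- At a critical point the Christoffel symbols vanish and only terms linear in the Hessian remain.
In dimension 4 they are `-2 Hess φ - (tr_η Hess φ) η`, which is `(-2c - 4c) η`. -/
theorem ricci_conformalMetric_of_critical {φ : R4 → ℝ} (hφ : ContDiff ℝ 2 φ) {p : R4} {c : ℝ}
    (h1 : ∀ i, partialD i φ p = 0)
    (h2 : ∀ i j, partialD i (partialD j φ) p = c * minkowski i j) :
    ricci (conformalMetric φ) p = (-6 * c) • minkowski := by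
  have hΓ : ∀ k i j, christoffel (conformalMetric φ) k i j p = 0 := fun k i j => by
    rw [christoffel_conformalMetric (hφ.differentiable (by simp))]
    simp [h1]
  ext i j
  simp only [ricci, Matrix.of_apply, hΓ, partialD_christoffel_conformalMetric hφ, h2,
    Fin.sum_univ_four, Matrix.smul_apply, smul_eq_mul, minkowski, Matrix.diagonal_apply]
  fin_cases i <;> fin_cases j <;> simp <;> ring

theorem continuous_conformalMetric {φ : R4 → ℝ} (hφ : Continuous φ) :
    Continuous (conformalMetric φ) :=
  (Real.continuous_exp.comp (continuous_const.mul hφ)).smul continuous_const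

theorem continuous_energyMomentum_conformalMetric {φ : R4 → ℝ} (hφ : ContDiff ℝ 2 φ) :
    Continuous (energyMomentum (conformalMetric φ)) := by
  have hR := continuous_ricci_conformalMetric hφ
  have hs : Continuous (scalarCurv (conformalMetric φ)) := by
    unfold scalarCurv
    simp only [inv_conformalMetric, Matrix.smul_apply, smul_eq_mul]
    refine continuous_finsetSum _ fun i _ => continuous_finsetSum _ fun j _ => ?_
    exact ((Real.continuous_exp.comp (continuous_const.mul hφ.continuous).neg).mul
      continuous_const).mul (hR.matrix_elem i j)
  have hg := continuous_conformalMetric hφ.continuous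
  change Continuous fun p => (1 / (8 * Real.pi)) • (ricci (conformalMetric φ) p
    - ((1 / 2) * scalarCurv (conformalMetric φ) p) • conformalMetric φ p)
  have hT : Continuous fun p => ricci (conformalMetric φ) p
      - ((1 / 2) * scalarCurv (conformalMetric φ) p) • conformalMetric φ p :=
    hR.sub ((continuous_const.mul hs).smul hg)
  exact hT.const_smul (1 / (8 * Real.pi) : ℝ)

theorem energyMomentum_conformalMetric_of_critical {φ : R4 → ℝ} (hφ : ContDiff ℝ 2 φ) {p : R4}
    {c : ℝ} (h1 : ∀ i, partialD i φ p = 0)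
    (h2 : ∀ i j, partialD i (partialD j φ) p = c * minkowski i j) :
    energyMomentum (conformalMetric φ) p = (3 * c / (4 * Real.pi)) • minkowski := by
  have hR := ricci_conformalMetric_of_critical hφ h1 h2
  have hs : scalarCurv (conformalMetric φ) p = Real.exp (-(2 * φ p)) * (-24 * c) := by
    rw [scalarCurv, hR, inv_conformalMetric]
    simp [Fin.sum_univ_four, minkowski]
    ring
  rw [energyMomentum, hR, hs, conformalMetric, smul_smul, ← sub_smul, smul_smul, Real.exp_neg]
  congr 1
  have := (Real.exp_pos (2 * φ p)).ne'
  field_simp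
  ring

/-! ### Odd extensions of functions on the half-line -/

theorem continuous_derivWithin_abs {g : ℝ → ℝ} (hg : ContDiffOn ℝ 1 g (Ici 0)) :
    Continuous fun r => derivWithin g (Ici 0) |r| :=
  (hg.continuousOn_derivWithin (uniqueDiffOn_Ici 0) le_rfl).comp_continuous continuous_abs
    fun r => mem_Ici.2 (abs_nonneg r)

/-- Integrating the even extension of the derivative gives an odd function that is automatically C¹
across `0`; two-sided calculus is then available on the whole line. -/
theorem isRadialProfile_integral_derivWithin {g : ℝ → ℝ} (hg : ContDiffOn ℝ 1 g (Ici 0)) :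
    IsRadialProfile (fun r => ∫ s in (0 : ℝ)..r, derivWithin g (Ici 0) |s|)
      fun r => derivWithin g (Ici 0) |r| where
  hasDerivAt _ :=
    have h := continuous_derivWithin_abs hg
    intervalIntegral.integral_hasDerivAt_right (h.intervalIntegrable _ _)
      (h.stronglyMeasurableAtFilter _ _) h.continuousAt
  continuous_deriv := continuous_derivWithin_abs hg
  map_zero := intervalIntegral.integral_same

theorem integral_derivWithin_abs {g : ℝ → ℝ} (hg : ContDiffOn ℝ 1 g (Ici 0)) (h0 : g 0 = 0)
    {r : ℝ} (hr : 0 ≤ r) : ∫ s in (0 : ℝ)..r, derivWithin g (Ici 0) |s| = g r := by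
  rw [intervalIntegral.integral_eq_sub_of_hasDeriv_right (f := g), h0, sub_zero]
  · refine hg.continuousOn.mono ?_
    rw [uIcc_of_le hr]
    exact Icc_subset_Ici_self
  · intro x hx
    rw [min_eq_left hr] at hx
    rw [abs_of_pos hx.1]
    exact ((hg.differentiableOn (by simp) x hx.1.le).hasDerivWithinAt.mono
      (Ioi_subset_Ici hx.1.le))
  · exact (continuous_derivWithin_abs hg).intervalIntegrable _ _

/-- `F` and `k` are the odd extensions of `f` and `f / f'`, with derivatives `D` and `k'`. -/
structure IsProfileOf (f F D k k' : ℝ → ℝ) : Prop where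
  profile : IsRadialProfile F D
  quotient : IsRadialProfile k k'
  one_le : ∀ r, 1 ≤ D r
  deriv_zero : D 0 = 1
  quotient_deriv_zero : k' 0 = 1
  quotient_mul : ∀ r, 0 ≤ r → k r * D r = F r
  eq : ∀ r, 0 ≤ r → f r = F r
  zeta_eq : zeta f = fun p => p 0 ^ 2 / 2 - ∫ s in (0 : ℝ)..radius p, k s

theorem exists_isProfileOf {f : ℝ → ℝ} (hf_smooth : ContDiffOn ℝ ∞ f (Ici 0))
    (hf_zero : (fun r => f r - r) =O[𝓝[≥] 0] fun r => r ^ 3)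
    (hf_deriv : ∀ r, 0 ≤ r → 1 ≤ deriv₀ f r) :
    ∃ F D k k' : ℝ → ℝ, IsProfileOf f F D k k' := by
  have hf1 : ContDiffOn ℝ 1 f (Ici 0) := hf_smooth.of_le (by norm_cast)
  have hd : ContDiffOn ℝ 1 (deriv₀ f) (Ici 0) :=
    hf_smooth.derivWithin (uniqueDiffOn_Ici 0) (m := 1) (by norm_cast)
  have hf0 : f 0 = 0 := by
    -- The filter `𝓝[≥] 0` contains the point `0`, where the cubic bound reads `|f 0| ≤ 0`.
    obtain ⟨C, hC⟩ := hf_zero.bound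
    simpa using hC.self_of_nhdsWithin self_mem_Ici
  have hderiv0 : HasDerivWithinAt f 1 (Ici 0) 0 := by
    rw [hasDerivWithinAt_iff_isLittleO]
    have h3 : (fun r : ℝ => r ^ 3) =o[𝓝[≥] 0] fun r : ℝ => r := by
      have := Asymptotics.isLittleO_pow_pow (𝕜 := ℝ) (m := 1) (n := 3) (by norm_num)
      simpa using this.mono nhdsWithin_le_nhds
    simpa [hf0] using hf_zero.trans_isLittleO h3
  have hd0 : deriv₀ f 0 = 1 := hderiv0.derivWithin (uniqueDiffOn_Ici 0 0 self_mem_Ici)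
  have hne : ∀ r ∈ Ici (0 : ℝ), deriv₀ f r ≠ 0 := fun r hr => by
    have := hf_deriv r hr
    positivity
  set h : ℝ → ℝ := fun r => f r / deriv₀ f r with hh
  have hh1 : ContDiffOn ℝ 1 h (Ici 0) := hf1.div hd hne
  have hh0 : h 0 = 0 := by simp [hh, hf0]
  -- In the quotient rule the term with the second derivative of `f` carries the factor `f 0 = 0`.
  -- The value `1` is what makes the Hessian of `ζ` at the origin a multiple of `η`.
  have hh' : derivWithin h (Ici 0) 0 = 1 := by
    have h1 := hderiv0.div ((hd.differentiableOn (by simp) 0 self_mem_Ici).hasDerivWithinAt)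
      (hne 0 self_mem_Ici)
    have := h1.derivWithin (uniqueDiffOn_Ici 0 0 self_mem_Ici)
    rw [hf0, hd0] at this
    norm_num at this
    exact this
  refine ⟨_, _, _, _, isRadialProfile_integral_derivWithin hf1,
    isRadialProfile_integral_derivWithin hh1, fun r => hf_deriv _ (abs_nonneg r), ?_, ?_,
    fun r hr => ?_, fun r hr => (integral_derivWithin_abs hf1 hf0 hr).symm, ?_⟩
  · rw [abs_zero]; exact hd0
  · rw [abs_zero]; exact hh'
  · rw [integral_derivWithin_abs hh1 hh0 hr, integral_derivWithin_abs hf1 hf0 hr, abs_of_nonneg hr]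
    exact div_mul_cancel₀ _ (hne r hr)
  · funext p
    rw [zeta]
    congr 1
    refine intervalIntegral.integral_congr fun s hs => ?_
    rw [uIcc_of_le (radius_nonneg p)] at hs
    exact (integral_derivWithin_abs hh1 hh0 hs.1).symm

/-! ### The comoving vector field -/

/-- The vector field `t ∂_t + k(r) ∂_r`. -/
noncomputable def radialFlow (k : ℝ → ℝ) (p : R4) : R4 := fun i =>
  if i = 0 then p 0 else radialField k i p

theorem radialFlow_zero (k : ℝ → ℝ) (p : R4) : radialFlow k p 0 = p 0 := rfl

theorem radialFlow_of_ne (k : ℝ → ℝ) (p : R4) {i : Fin 4} (hi : i ≠ 0) :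
    radialFlow k p i = radialField k i p := if_neg hi

theorem sum_sq_radialField {k k' : ℝ → ℝ} (hk : IsRadialProfile k k') (p : R4) :
    radialField k 1 p ^ 2 + radialField k 2 p ^ 2 + radialField k 3 p ^ 2 = k (radius p) ^ 2 := by
  rw [← hk.dslope_mul_self (radius p), mul_pow, radius_sq]
  simp only [radialField]
  ring

theorem bil_radialFlow {k k' : ℝ → ℝ} (hk : IsRadialProfile k k') (p : R4) :
    bil minkowski (radialFlow k p) (radialFlow k p) = -(p 0 ^ 2 - k (radius p) ^ 2) := by
  rw [bil_minkowski, ← sum_sq_radialField hk]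
  simp only [radialFlow]
  simp
  ring

/-- The exponent of the conformal factor of the example metrics. -/
noncomputable def exampleFactor (f Φ : ℝ → ℝ) (p : R4) : ℝ := Φ (zeta f p)

theorem exampleMetric_eq (f Φ : ℝ → ℝ) :
    exampleMetric f Φ = conformalMetric (exampleFactor f Φ) := rfl

theorem bil_timeOrientation (φ : R4 → ℝ) (p v : R4) :
    bil (conformalMetric φ p) (timeOrientation p) v = -(Real.exp (2 * φ p) * v 0) := by
  rw [bil_conformalMetric, timeOrientation, bil_minkowski_coordVec_zero, mul_neg]

theorem region_zero (f : ℝ → ℝ) : region f 0 = {p | f (radius p) < p 0} := by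
  simp [region]

theorem zeta_zero (f : ℝ → ℝ) : zeta f 0 = 0 := by
  simp [zeta, radius_zero]

namespace IsProfileOf

variable {f F D k k' : ℝ → ℝ} (h : IsProfileOf f F D k k')
include h

theorem contDiff_zeta : ContDiff ℝ 2 (zeta f) := by
  rw [h.zeta_eq]
  exact h.quotient.contDiff_potential

theorem partialD_zeta (i : Fin 4) (p : R4) :
    partialD i (zeta f) p = -(minkowski *ᵥ radialFlow k p) i := by
  rw [partialD, h.zeta_eq, (h.quotient.hasFDerivAt_potential p).fderiv, minkowski,
    Matrix.mulVec_diagonal]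
  fin_cases i <;> simp [coordVec, radialFlow]

theorem strictMono : StrictMono F :=
  strictMono_of_deriv_pos fun r => by
    rw [(h.profile.hasDerivAt r).deriv]
    exact zero_lt_one.trans_le (h.one_le r)

theorem nonneg {r : ℝ} (hr : 0 ≤ r) : 0 ≤ F r :=
  h.profile.map_zero.symm.trans_le (h.strictMono.monotone hr)

theorem quotient_nonneg {r : ℝ} (hr : 0 ≤ r) : 0 ≤ k r := by
  have h1 := h.nonneg hr
  rw [← h.quotient_mul r hr] at h1
  exact nonneg_of_mul_nonneg_left h1 (zero_lt_one.trans_le (h.one_le r))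

/-- Through this consequence of `f' ≥ 1`, the region `t > f(r)` lies inside `t > k(r)`, where `t ∂_t
+ k(r) ∂_r` is timelike. -/
theorem quotient_le {r : ℝ} (hr : 0 ≤ r) : k r ≤ F r := by
  rw [← h.quotient_mul r hr]
  exact le_mul_of_one_le_right (h.quotient_nonneg hr) (h.one_le r)

theorem mem_region {ε : ℝ} {p : R4} : p ∈ region f ε ↔ (1 + ε) * F (radius p) < p 0 := by
  rw [region, mem_ofPred_eq, h.eq _ (radius_nonneg p)]

theorem quotient_lt_of_mem_region {ε : ℝ} (hε : 0 ≤ ε) {p : R4} (hp : p ∈ region f ε) :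
    (1 + ε) * k (radius p) < p 0 :=
  (mul_le_mul_of_nonneg_left (h.quotient_le (radius_nonneg p)) (by linarith)).trans_lt
    (h.mem_region.1 hp)

theorem time_pos_of_mem_region {ε : ℝ} (hε : 0 ≤ ε) {p : R4} (hp : p ∈ region f ε) : 0 < p 0 :=
  (mul_nonneg (by linarith) (h.nonneg (radius_nonneg p))).trans_lt (h.mem_region.1 hp)

theorem sq_lt_of_mem_region {ε : ℝ} (hε : 0 ≤ ε) {p : R4} (hp : p ∈ region f ε) :
    0 < p 0 ^ 2 - k (radius p) ^ 2 := by
  have h1 := h.quotient_lt_of_mem_region hε hp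
  have h2 := h.quotient_nonneg (radius_nonneg p)
  nlinarith [mul_nonneg hε h2]

theorem isOpen_region (ε : ℝ) : IsOpen (region f ε) := by
  have : region f ε = {p | (1 + ε) * F (radius p) < p 0} := by
    ext p; exact h.mem_region
  rw [this]
  exact isOpen_lt (continuous_const.mul (h.profile.continuous.comp continuous_radius))
    (continuous_apply 0)

theorem zero_notMem_region (ε : ℝ) : (0 : R4) ∉ region f ε := by
  rw [h.mem_region]
  simp [radius_zero, h.profile.map_zero]

/-- A continuous vertical shear by `(1 + ε) f(r)`, which leaves `r` unchanged, carries the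
half-space `t > 0` onto the region. -/
theorem isConnected_region (ε : ℝ) : IsConnected (region f ε) := by
  have h1 : IsConnected {p : R4 | 0 < p 0} :=
    ⟨⟨coordVec 0, by simp [coordVec]⟩,
      (convex_halfSpace_gt (coordForm 0).isLinear 0).isPreconnected⟩
  have h2 : region f ε = (fun p : R4 => p + ((1 + ε) * F (radius p)) • coordVec 0) ''
      {p : R4 | 0 < p 0} := by
    have hr : ∀ (p : R4) (s : ℝ), radius (p + s • coordVec 0) = radius p := fun p s => by
      simp [radius, coordVec]
    ext p
    rw [h.mem_region]
    constructor
    · intro hp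
      refine ⟨p + (-((1 + ε) * F (radius p))) • coordVec 0, ?_, ?_⟩
      · simpa [coordVec] using hp
      · simp only [hr]
        rw [add_assoc, ← add_smul, neg_add_cancel, zero_smul, add_zero]
    · rintro ⟨q, hq, rfl⟩
      simp only [hr]
      simpa [coordVec] using hq
  rw [h2]
  refine h1.image _ (Continuous.continuousOn ?_)
  exact continuous_id.add ((continuous_const.mul
    (h.profile.continuous.comp continuous_radius)).smul continuous_const)

theorem contDiff_exampleFactor {Φ : ℝ → ℝ} (hΦ : ContDiff ℝ 2 Φ) :
    ContDiff ℝ 2 (exampleFactor f Φ) :=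
  hΦ.comp h.contDiff_zeta

theorem metricGradient_zeta (φ : R4 → ℝ) (p : R4) :
    metricGradient (conformalMetric φ) (zeta f) p
      = -(Real.exp (-(2 * φ p)) • radialFlow k p) := by
  have : (fun ν => partialD ν (zeta f) p) = -(minkowski *ᵥ radialFlow k p) := by
    funext ν
    exact h.partialD_zeta ν p
  rw [metricGradient, this, inv_conformalMetric, Matrix.smul_mulVec, Matrix.mulVec_neg,
    Matrix.mulVec_mulVec, minkowski_mul_self, Matrix.one_mulVec, smul_neg]

theorem comovingField_eq {Φ : ℝ → ℝ} {p : R4} (hp : 0 < p 0 ^ 2 - k (radius p) ^ 2) :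
    comovingField f Φ p = (Real.exp (-exampleFactor f Φ p) / √(p 0 ^ 2 - k (radius p) ^ 2)) •
      radialFlow k p := by
  have hb : bil (exampleMetric f Φ p) (-(Real.exp (-(2 * exampleFactor f Φ p)) • radialFlow k p))
      (-(Real.exp (-(2 * exampleFactor f Φ p)) • radialFlow k p))
      = -(Real.exp (-exampleFactor f Φ p) ^ 2 * (p 0 ^ 2 - k (radius p) ^ 2)) := by
    rw [exampleMetric_eq, bil_conformalMetric]
    have : ∀ (c : ℝ) (v : R4), bil minkowski (-(c • v)) (-(c • v)) = c ^ 2 * bil minkowski v v :=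
      fun c v => by simp [bil_minkowski]; ring
    rw [this, bil_radialFlow h.quotient, mul_neg, mul_neg, ← mul_assoc]
    congr 2
    rw [← Real.exp_nat_mul, ← Real.exp_nat_mul, ← Real.exp_add]
    congr 1
    push_cast
    ring
  have he := Real.exp_pos (-exampleFactor f Φ p)
  have hs := Real.sqrt_pos.2 hp
  rw [comovingField, exampleMetric_eq, h.metricGradient_zeta, vecNorm, ← exampleMetric_eq, hb,
    abs_neg, abs_of_pos (by positivity), Real.sqrt_mul (by positivity), Real.sqrt_sq he.le,
    smul_neg, neg_neg, smul_smul]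
  congr 1
  rw [show -(2 * exampleFactor f Φ p) = -exampleFactor f Φ p + -exampleFactor f Φ p by ring,
    Real.exp_add]
  field_simp

theorem comovingField_apply {Φ : ℝ → ℝ} {ε : ℝ} (hε : 0 ≤ ε) {p : R4} (hp : p ∈ region f ε) :
    ∃ c : ℝ, 0 < c ∧ comovingField f Φ p = c • radialFlow k p :=
  ⟨_, div_pos (Real.exp_pos _) (Real.sqrt_pos.2 (h.sq_lt_of_mem_region hε hp)),
    h.comovingField_eq (Φ := Φ) (h.sq_lt_of_mem_region hε hp)⟩

theorem contDiff_sq_quotient : ContDiff ℝ 1 fun p => k (radius p) ^ 2 := by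
  simp_rw [← sum_sq_radialField h.quotient]
  exact (((h.quotient.contDiff_radialField (by simp)).pow 2).add
    ((h.quotient.contDiff_radialField (by simp)).pow 2)).add
    ((h.quotient.contDiff_radialField (by simp)).pow 2)

theorem contDiff_radialFlow : ContDiff ℝ 1 (radialFlow k) := by
  refine contDiff_pi.2 fun i => ?_
  by_cases hi : i = 0
  · subst hi
    exact contDiff_apply ℝ ℝ 0
  · simp_rw [radialFlow_of_ne k _ hi]
    exact h.quotient.contDiff_radialField hi

theorem contDiffOn_comovingField {Φ : ℝ → ℝ} (hΦ : ContDiff ℝ 2 Φ) {ε : ℝ} (hε : 0 ≤ ε) :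
    ContDiffOn ℝ 1 (comovingField f Φ) (region f ε) := by
  have h1 : ContDiffOn ℝ 1 (fun p => (Real.exp (-exampleFactor f Φ p) /
      √(p 0 ^ 2 - k (radius p) ^ 2)) • radialFlow k p) (region f ε) := by
    refine ContDiffOn.smul (ContDiffOn.div ?_ (ContDiffOn.sqrt ?_ fun p hp =>
      (h.sq_lt_of_mem_region hε hp).ne') fun p hp =>
      (Real.sqrt_pos.2 (h.sq_lt_of_mem_region hε hp)).ne') h.contDiff_radialFlow.contDiffOn
    · exact ((h.contDiff_exampleFactor hΦ).of_le (by norm_num)).neg.exp.contDiffOn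
    · exact (((contDiff_apply ℝ ℝ (0 : Fin 4)).pow 2).sub h.contDiff_sq_quotient).contDiffOn
  exact h1.congr fun p hp => h.comovingField_eq (h.sq_lt_of_mem_region hε hp)

theorem bil_comovingField {Φ : ℝ → ℝ} {ε : ℝ} (hε : 0 ≤ ε) {p : R4} (hp : p ∈ region f ε) :
    bil (exampleMetric f Φ p) (comovingField f Φ p) (comovingField f Φ p) = -1 := by
  have h0 := h.sq_lt_of_mem_region hε hp
  have : ∀ (c : ℝ) (v : R4), bil minkowski (c • v) (c • v) = c ^ 2 * bil minkowski v v :=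
    fun c v => by simp [bil_minkowski]; ring
  rw [exampleMetric_eq, bil_conformalMetric, h.comovingField_eq h0, this,
    bil_radialFlow h.quotient, div_pow, Real.sq_sqrt h0.le, ← Real.exp_nat_mul]
  push_cast
  rw [mul_neg, div_mul_eq_mul_div, mul_div_cancel_right₀ _ h0.ne', mul_neg, mul_neg,
    ← Real.exp_add]
  simp

theorem isUnitFutureTimelikeField {Φ : ℝ → ℝ} (hΦ : ContDiff ℝ 2 Φ) {ε : ℝ} (hε : 0 ≤ ε) :
    IsUnitFutureTimelikeField (region f ε) (exampleMetric f Φ) timeOrientation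
      (comovingField f Φ) where
  contDiff := h.contDiffOn_comovingField hΦ hε
  unit p hp := h.bil_comovingField hε hp
  future p hp := by
    obtain ⟨c, hc, hu⟩ := h.comovingField_apply (Φ := Φ) hε hp
    rw [exampleMetric_eq, bil_timeOrientation, hu, Pi.smul_apply, radialFlow_zero, smul_eq_mul]
    exact neg_neg_of_pos (mul_pos (Real.exp_pos _)
      (mul_pos hc (h.time_pos_of_mem_region hε hp)))

theorem isSpacetime {Φ : ℝ → ℝ} (hΦ : ContDiff ℝ 2 Φ) {M : Set R4} (hM : IsOpen M)
    (hM' : IsConnected M) {n : ℕ∞} (hn : (n : WithTop ℕ∞) ≤ 2) :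
    IsSpacetime n M (exampleMetric f Φ) timeOrientation := by
  have h1 := contDiff_conformalMetric (h.contDiff_exampleFactor hΦ)
  rw [exampleMetric_eq]
  have h3 : ContinuousOn timeOrientation M := by
    unfold timeOrientation
    exact continuousOn_const
  have h4 : ∀ p, timeOrientation p 0 = 1 := fun _ => coordVec_zero_apply_zero
  refine ⟨hM, hM', fun μ ν => ?_, fun p _ => ?_, h3, fun p _ => ?_⟩
  · exact ((h1 μ ν).of_le hn).contDiffOn
  · exact isLorentzian_conformalMetric _ p
  · rw [bil_timeOrientation, h4, mul_one]
    exact neg_neg_of_pos (Real.exp_pos _)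

theorem partialD_exampleFactor {Φ : ℝ → ℝ} (hΦ : ContDiff ℝ 2 Φ) (i : Fin 4) (p : R4) :
    partialD i (exampleFactor f Φ) p = deriv Φ (zeta f p) * partialD i (zeta f) p := by
  have h1 := ((hΦ.differentiable (by simp)) (zeta f p)).hasDerivAt
  have h2 := ((h.contDiff_zeta.differentiable (by simp)) p).hasFDerivAt
  have h3 : HasFDerivAt (exampleFactor f Φ) _ p := h1.comp_hasFDerivAt p h2
  rw [partialD, h3.fderiv]
  rfl

theorem partialD_exampleFactor_zero {Φ : ℝ → ℝ} (hΦ : ContDiff ℝ 2 Φ) (i : Fin 4) :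
    partialD i (exampleFactor f Φ) 0 = 0 := by
  have : radialFlow k 0 = 0 := by
    funext i
    simp [radialFlow, radialField]
  rw [h.partialD_exampleFactor hΦ, h.partialD_zeta, this]
  simp

/-- Since `k'(0) = 1`, the linearization of `t ∂_t + k(r) ∂_r` at the origin is the identity, and
`dζ` is minus the `η`-dual of this field. -/
theorem partialD_partialD_zeta_zero (i j : Fin 4) :
    partialD i (partialD j (zeta f)) 0 = -minkowski i j := by
  have h1 : partialD j (zeta f) = fun p => -(minkowski j j * radialFlow k p j) := by
    funext p
    rw [h.partialD_zeta, minkowski, Matrix.mulVec_diagonal, Matrix.diagonal_apply_eq]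
  have h2 : DifferentiableAt ℝ (fun p => radialFlow k p j) 0 :=
    differentiableAt_pi.1 (h.contDiff_radialFlow.differentiable (by simp) 0) j
  have h3 : partialD i (fun p => radialFlow k p j) 0 = if i = j then 1 else 0 := by
    by_cases hj : j = 0
    · subst hj
      simp only [radialFlow_zero, partialD, (hasFDerivAt_coord 0 0).fderiv]
      simp [coordVec, Pi.single_apply, eq_comm]
    · simp only [radialFlow_of_ne k _ hj]
      exact (h.quotient.partialD_radialField_zero hj i).trans (by rw [h.quotient_deriv_zero])
  rw [h1, partialD, ((h2.hasFDerivAt.const_mul _).fun_neg).fderiv]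
  change -(minkowski j j * partialD i (fun p => radialFlow k p j) 0) = _
  rw [h3]
  split_ifs with hij
  · subst hij
    simp
  · simp [minkowski, Matrix.diagonal_apply_ne _ hij]

/-- The term containing `Φ''` carries a factor `dζ`, which vanishes at the origin. -/
theorem partialD_partialD_exampleFactor_zero {Φ : ℝ → ℝ} (hΦ : ContDiff ℝ 2 Φ) (i j : Fin 4) :
    partialD i (partialD j (exampleFactor f Φ)) 0 = -deriv Φ 0 * minkowski i j := by
  have h1 : DifferentiableAt ℝ (fun p => deriv Φ (zeta f p)) 0 := by
    have : ContDiff ℝ 1 (deriv Φ) := hΦ.deriv' (n := 1)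
    exact (this.differentiable (by simp) _).comp _ (h.contDiff_zeta.differentiable (by simp) 0)
  have h2 : DifferentiableAt ℝ (partialD j (zeta f)) 0 :=
    (contDiff_partialD (n := 1) (by simpa [one_add_one_eq_two] using h.contDiff_zeta)
      j).differentiable (by simp) 0
  have h3 : partialD j (exampleFactor f Φ)
      = fun p => deriv Φ (zeta f p) * partialD j (zeta f) p :=
    funext fun p => h.partialD_exampleFactor hΦ j p
  have h4 : partialD j (zeta f) 0 = 0 := by
    rw [h.partialD_zeta]
    have : radialFlow k 0 = 0 := by
      funext i
      simp [radialFlow, radialField]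
    simp [this]
  rw [h3, partialD, (h1.hasFDerivAt.fun_mul h2.hasFDerivAt).fderiv]
  simp only [h4, zeta_zero]
  have := h.partialD_partialD_zeta_zero i j
  rw [partialD] at this
  simp [this]

theorem ricci_exampleMetric_zero {Φ : ℝ → ℝ} (hΦ : ContDiff ℝ 2 Φ) :
    ricci (exampleMetric f Φ) 0 = (6 * deriv Φ 0) • minkowski := by
  rw [exampleMetric_eq, ricci_conformalMetric_of_critical (h.contDiff_exampleFactor hΦ)
    (h.partialD_exampleFactor_zero hΦ) (h.partialD_partialD_exampleFactor_zero hΦ)]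
  congr 1
  ring

theorem energyMomentum_exampleMetric_zero {Φ : ℝ → ℝ} (hΦ : ContDiff ℝ 2 Φ) :
    energyMomentum (exampleMetric f Φ) 0 = (-(3 * deriv Φ 0 / (4 * Real.pi))) • minkowski := by
  rw [exampleMetric_eq, energyMomentum_conformalMetric_of_critical (h.contDiff_exampleFactor hΦ)
    (h.partialD_exampleFactor_zero hΦ) (h.partialD_partialD_exampleFactor_zero hΦ)]
  congr 1
  ring

end IsProfileOf

/-! ### Inverses of increasing functions -/

theorem isOpenMap_of_hasDerivAt_pos {A α : ℝ → ℝ} (hA : ∀ t, HasDerivAt A (α t) t)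
    (hα : Continuous α) (hpos : ∀ t, 0 < α t) : IsOpenMap A :=
  isOpenMap_of_hasStrictDerivAt (fun _ => hasStrictDerivAt_of_hasDerivAt_of_continuousAt
    (Eventually.of_forall hA) hα.continuousAt) fun t => (hpos t).ne'

/-- `A` need not be surjective: total proper time may be finite. As `A` is an open map, `invFun A`
is a genuine inverse near each value `A t`, and its arbitrary values off the range do not matter. -/
theorem hasDerivAt_invFun {A α : ℝ → ℝ} (hA : ∀ t, HasDerivAt A (α t) t)
    (hα : Continuous α) (hpos : ∀ t, 0 < α t) (t : ℝ) :
    HasDerivAt (Function.invFun A) (α t)⁻¹ (A t) := by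
  have hinj := (strictMono_of_hasDerivAt_pos hA hpos).injective
  have hopen := isOpenMap_of_hasDerivAt_pos hA hα hpos
  have hl : ∀ s, Function.invFun A (A s) = s := Function.leftInverse_invFun hinj
  refine HasDerivAt.of_local_left_inverse ?_ (by rw [hl]; exact hA t) (hpos t).ne' ?_
  · intro U hU
    rw [hl] at hU
    change Function.invFun A ⁻¹' U ∈ 𝓝 (A t)
    filter_upwards [hopen.image_mem_nhds hU] with s hs
    obtain ⟨x, hx, rfl⟩ := hs
    rwa [mem_preimage, hl]
  · filter_upwards [hopen.image_mem_nhds (univ_mem (f := 𝓝 t))] with s hs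
    obtain ⟨x, -, rfl⟩ := hs
    rw [hl]

/-! ### The flow lines of the comoving field -/

/-- The curve `f(r) = |w| t` in the direction of the spatial part of `w`. -/
noncomputable def fluidLine (F : ℝ → ℝ) (w : R4) (t : ℝ) : R4 := fun i =>
  if i = 0 then t else Function.invFun F (radius w * t) * (w i / radius w)

/-- The velocity of `fluidLine F w`, where `D` is the derivative of `F`. -/
noncomputable def fluidLineDeriv (F D : ℝ → ℝ) (w : R4) (t : ℝ) : R4 := fun i =>
  if i = 0 then 1 else radius w / D (Function.invFun F (radius w * t)) * (w i / radius w)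

/-- The rate of proper time along `fluidLine F w`. -/
noncomputable def properTimeRate (f Φ F D : ℝ → ℝ) (w : R4) (t : ℝ) : ℝ :=
  Real.exp (exampleFactor f Φ (fluidLine F w t)) *
    √(1 - (radius w / D (Function.invFun F (radius w * t))) ^ 2)

/-- Proper time along `fluidLine F w`. -/
noncomputable def properTime (f Φ F D : ℝ → ℝ) (w : R4) (t : ℝ) : ℝ :=
  ∫ s in (0 : ℝ)..t, properTimeRate f Φ F D w s

/-- The flow line `fluidLine F w`, parametrized by proper time. -/
noncomputable def fluidCurve (f Φ F D : ℝ → ℝ) (w : R4) (τ : ℝ) : R4 :=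
  fluidLine F w (Function.invFun (properTime f Φ F D w) τ)

/-- The vector `f(r) / t` in radial direction, constant along the flow lines. -/
noncomputable def fluidVelocity (F : ℝ → ℝ) (p : R4) : R4 := fun i =>
  if i = 0 then 0 else radialField F i p / p 0

theorem properTime_zero (f Φ F D : ℝ → ℝ) (w : R4) : properTime f Φ F D w 0 = 0 :=
  intervalIntegral.integral_same

namespace IsProfileOf

variable {f F D k k' : ℝ → ℝ} (h : IsProfileOf f F D k k')
include h

theorem deriv_pos (r : ℝ) : 0 < D r := zero_lt_one.trans_le (h.one_le r)

/-- Since `F' ≥ 1`, the function `F r - r` is nondecreasing, so `F` dominates the identity at both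
ends of the line. -/
theorem surjective : Function.Surjective F := by
  have hmono : Monotone fun r => F r - r := by
    have hd : ∀ r, HasDerivAt (fun r => F r - r) (D r - 1) r := fun r =>
      (h.profile.hasDerivAt r).sub (hasDerivAt_id r)
    refine monotone_of_deriv_nonneg (fun r => (hd r).differentiableAt) fun r => ?_
    rw [(hd r).deriv]
    exact sub_nonneg.2 (h.one_le r)
  have h0 := h.profile.map_zero
  refine h.profile.continuous.surjective ?_ ?_
  · refine tendsto_atTop_mono' _ ?_ tendsto_id
    filter_upwards [eventually_ge_atTop 0] with r hr
    have := hmono hr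
    simp only [h0] at this
    simp only [id]
    linarith
  · refine tendsto_atBot_mono' _ ?_ tendsto_id
    filter_upwards [eventually_le_atBot 0] with r hr
    have := hmono hr
    simp only [h0] at this
    simp only [id]
    linarith

theorem apply_invFun (y : ℝ) : F (Function.invFun F y) = y :=
  Function.rightInverse_invFun h.surjective y

theorem invFun_apply (r : ℝ) : Function.invFun F (F r) = r :=
  Function.leftInverse_invFun h.strictMono.injective r

theorem invFun_zero : Function.invFun F 0 = 0 := by
  conv_lhs => rw [← h.profile.map_zero]
  exact h.invFun_apply 0

theorem invFun_nonneg {y : ℝ} (hy : 0 ≤ y) : 0 ≤ Function.invFun F y := by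
  rwa [← h.strictMono.le_iff_le, h.profile.map_zero, h.apply_invFun]

theorem hasDerivAt_invFun (y : ℝ) :
    HasDerivAt (Function.invFun F) (D (Function.invFun F y))⁻¹ y := by
  have := _root_.hasDerivAt_invFun h.profile.hasDerivAt h.profile.continuous_deriv h.deriv_pos
    (Function.invFun F y)
  rwa [h.apply_invFun] at this

theorem continuous_invFun : Continuous (Function.invFun F) :=
  continuous_iff_continuousAt.2 fun y => (h.hasDerivAt_invFun y).continuousAt

theorem hasDerivAt_fluidLine (w : R4) (t : ℝ) :
    HasDerivAt (fluidLine F w) (fluidLineDeriv F D w t) t := by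
  refine hasDerivAt_pi.2 fun i => ?_
  by_cases hi : i = 0
  · simpa [fluidLine, fluidLineDeriv, hi] using hasDerivAt_id' t
  · simp only [fluidLine, fluidLineDeriv, hi, if_false]
    have h1 : HasDerivAt (fun t => radius w * t) (radius w) t := by
      simpa using (hasDerivAt_id t).const_mul (radius w)
    have h2 := ((h.hasDerivAt_invFun (radius w * t)).comp t h1).mul_const (w i / radius w)
    refine h2.congr_deriv ?_
    ring

theorem continuous_fluidLine (w : R4) : Continuous (fluidLine F w) :=
  continuous_iff_continuousAt.2 fun t => (h.hasDerivAt_fluidLine w t).continuousAt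

theorem continuous_slope (w : R4) :
    Continuous fun t => radius w / D (Function.invFun F (radius w * t)) := by
  refine continuous_const.div ?_ fun t => (h.deriv_pos _).ne'
  exact h.profile.continuous_deriv.comp
    (h.continuous_invFun.comp (continuous_const.mul continuous_id))

theorem continuous_fluidLineDeriv (w : R4) : Continuous (fluidLineDeriv F D w) := by
  refine continuous_pi fun i => ?_
  by_cases hi : i = 0
  · simp only [fluidLineDeriv, hi, if_true]
    exact continuous_const
  · simp only [fluidLineDeriv, hi, if_false]
    exact (h.continuous_slope w).mul continuous_const

theorem fluidLine_zero (w : R4) : fluidLine F w 0 = 0 := by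
  funext i
  simp [fluidLine, h.invFun_zero]

theorem radius_fluidLine (w : R4) {t : ℝ} (ht : 0 ≤ t) :
    radius (fluidLine F w t) = Function.invFun F (radius w * t) := by
  have hG := h.invFun_nonneg (mul_nonneg (radius_nonneg w) ht)
  rw [← Real.sqrt_sq hG, radius]
  congr 1
  simp only [fluidLine, Fin.isValue, one_ne_zero, if_false, Fin.reduceEq]
  rcases eq_or_ne (radius w) 0 with hw | hw
  · simp [hw, h.invFun_zero]
  · have := radius_sq w
    field_simp
    rw [this]
    ring

theorem fluidLine_mem_region {ε : ℝ} {w : R4} (hw : (1 + ε) * radius w < 1) {t : ℝ} (ht : 0 < t) :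
    fluidLine F w t ∈ region f ε := by
  rw [h.mem_region, h.radius_fluidLine w ht.le, h.apply_invFun]
  simp only [fluidLine, if_true]
  nlinarith

theorem slope_sq_lt {w : R4} (hw : radius w < 1) (t : ℝ) :
    0 < 1 - (radius w / D (Function.invFun F (radius w * t))) ^ 2 := by
  have h1 : radius w / D (Function.invFun F (radius w * t)) < 1 :=
    (div_le_self (radius_nonneg w) (h.one_le _)).trans_lt hw
  have h2 : 0 ≤ radius w / D (Function.invFun F (radius w * t)) :=
    div_nonneg (radius_nonneg w) (h.deriv_pos _).le
  nlinarith

/-- Differentiating `f(r) = |w| t` gives `t dr/dt = |w| t / f'(r) = f(r) / f'(r) = k(r)`. -/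
theorem radialFlow_fluidLine (w : R4) {t : ℝ} (ht : 0 ≤ t) :
    radialFlow k (fluidLine F w t) = t • fluidLineDeriv F D w t := by
  funext i
  by_cases hi : i = 0
  · simp [radialFlow, fluidLineDeriv, fluidLine, hi]
  · have hr := h.radius_fluidLine w ht
    have hG := h.invFun_nonneg (mul_nonneg (radius_nonneg w) ht)
    have h1 := h.quotient_mul _ hG
    rw [h.apply_invFun, ← h.quotient.dslope_mul_self] at h1
    have hD := (h.deriv_pos (Function.invFun F (radius w * t))).ne'
    simp only [radialFlow, radialField, hi, if_false, hr, Pi.smul_apply, smul_eq_mul,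
      fluidLineDeriv]
    simp only [fluidLine, hi, if_false]
    rw [← mul_assoc, ← mul_assoc]
    congr 1
    field_simp
    rw [h1, mul_comm]

theorem comovingField_fluidLine {Φ : ℝ → ℝ} {w : R4} (hw : radius w < 1) {t : ℝ} (ht : 0 < t) :
    comovingField f Φ (fluidLine F w t)
      = (properTimeRate f Φ F D w t)⁻¹ • fluidLineDeriv F D w t := by
  have hk : k (radius (fluidLine F w t))
      = t * (radius w / D (Function.invFun F (radius w * t))) := by
    have hG := h.invFun_nonneg (mul_nonneg (radius_nonneg w) ht.le)
    rw [h.radius_fluidLine w ht.le, mul_div_assoc', eq_div_iff (h.deriv_pos _).ne',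
      h.quotient_mul _ hG, h.apply_invFun, mul_comm]
  have h0 : fluidLine F w t 0 ^ 2 - k (radius (fluidLine F w t)) ^ 2
      = t ^ 2 * (1 - (radius w / D (Function.invFun F (radius w * t))) ^ 2) := by
    rw [hk]
    simp only [fluidLine, if_true]
    ring
  have hs := h.slope_sq_lt hw t
  have hs' := Real.sqrt_pos.2 hs
  rw [h.comovingField_eq (by rw [h0]; positivity), h0, Real.sqrt_mul (by positivity),
    Real.sqrt_sq ht.le, h.radialFlow_fluidLine w ht.le, smul_smul, properTimeRate, Real.exp_neg]
  congr 1
  field_simp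

theorem fluidVelocity_spec {p : R4} (hp : 0 < p 0) :
    radius (fluidVelocity F p) = F (radius p) / p 0 ∧
      fluidLine F (fluidVelocity F p) (p 0) = p := by
  have h1 : radius (fluidVelocity F p) = F (radius p) / p 0 := by
    rw [← Real.sqrt_sq (div_nonneg (h.nonneg (radius_nonneg p)) hp.le), div_pow,
      ← sum_sq_radialField h.profile, radius]
    congr 1
    simp [fluidVelocity]
    ring
  refine ⟨h1, ?_⟩
  funext i
  by_cases hi : i = 0
  · simp [fluidLine, hi]
  · simp only [fluidLine, hi, if_false, h1, div_mul_cancel₀ _ hp.ne', h.invFun_apply,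
      fluidVelocity, radialField]
    rw [← h.profile.dslope_mul_self (radius p)]
    rcases eq_or_ne (radius p) 0 with hr | hr
    · simp [hr, apply_eq_zero_of_radius_eq_zero hr hi]
    · have hQ : dslope F 0 (radius p) ≠ 0 := by
        rw [h.profile.dslope_of_ne hr]
        refine div_ne_zero (fun h0 => hr (h.strictMono.injective ?_)) hr
        rw [h0, h.profile.map_zero]
      field_simp

variable {Φ : ℝ → ℝ} (hΦ : ContDiff ℝ 2 Φ)
include hΦ

theorem continuous_properTimeRate (w : R4) : Continuous (properTimeRate f Φ F D w) := by
  refine Continuous.mul ?_ (continuous_const.sub ((h.continuous_slope w).pow 2)).sqrt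
  exact Real.continuous_exp.comp
    ((h.contDiff_exampleFactor hΦ).continuous.comp (h.continuous_fluidLine w))

omit hΦ in
theorem properTimeRate_pos {w : R4} (hw : radius w < 1) (t : ℝ) :
    0 < properTimeRate f Φ F D w t :=
  mul_pos (Real.exp_pos _) (Real.sqrt_pos.2 (h.slope_sq_lt hw t))

theorem hasDerivAt_properTime (w : R4) (t : ℝ) :
    HasDerivAt (properTime f Φ F D w) (properTimeRate f Φ F D w t) t :=
  have hc := h.continuous_properTimeRate hΦ w
  intervalIntegral.integral_hasDerivAt_right (hc.intervalIntegrable _ _)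
    (hc.stronglyMeasurableAtFilter _ _) hc.continuousAt

theorem strictMono_properTime {w : R4} (hw : radius w < 1) : StrictMono (properTime f Φ F D w) :=
  strictMono_of_hasDerivAt_pos (h.hasDerivAt_properTime hΦ w) (h.properTimeRate_pos hw)

theorem fluidCurve_properTime {w : R4} (hw : radius w < 1) (t : ℝ) :
    fluidCurve f Φ F D w (properTime f Φ F D w t) = fluidLine F w t := by
  rw [fluidCurve, Function.leftInverse_invFun (h.strictMono_properTime hΦ hw).injective]

theorem hasDerivAt_fluidCurve {w : R4} (hw : radius w < 1) (t : ℝ) :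
    HasDerivAt (fluidCurve f Φ F D w) ((properTimeRate f Φ F D w t)⁻¹ • fluidLineDeriv F D w t)
      (properTime f Φ F D w t) := by
  have h1 := _root_.hasDerivAt_invFun (h.hasDerivAt_properTime hΦ w)
    (h.continuous_properTimeRate hΦ w) (h.properTimeRate_pos hw) t
  refine HasDerivAt.scomp (properTime f Φ F D w t) ?_ h1
  rw [Function.leftInverse_invFun (h.strictMono_properTime hΦ hw).injective]
  exact h.hasDerivAt_fluidLine w t

theorem isIntegralCurveIn_fluidCurve {ε : ℝ} (hε : 0 ≤ ε) {w : R4} (hw : (1 + ε) * radius w < 1)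
    (a : ℝ) :
    IsIntegralCurveIn (region f ε) (comovingField f Φ) (fun τ => fluidCurve f Φ F D w (τ - a))
      ((fun τ => τ - a) ⁻¹' (properTime f Φ F D w '' Ioi 0)) := by
  have hw1 : radius w < 1 := by nlinarith [radius_nonneg w, mul_nonneg hε (radius_nonneg w)]
  have hopen := isOpenMap_of_hasDerivAt_pos (h.hasDerivAt_properTime hΦ w)
    (h.continuous_properTimeRate hΦ w) (h.properTimeRate_pos hw1)
  have hcont : Continuous (properTime f Φ F D w) :=
    continuous_iff_continuousAt.2 fun t => (h.hasDerivAt_properTime hΦ w t).continuousAt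
  refine ⟨⟨properTime f Φ F D w 1 + a, 1, by simp, by simp⟩,
    (hopen _ isOpen_Ioi).preimage (continuous_id.sub continuous_const), ?_, ?_, ?_⟩
  · have := (isPreconnected_Ioi.image _ (hcont.continuousOn (s := Ioi 0))).ordConnected
    exact this.preimage_mono fun x y hxy => sub_le_sub_right hxy a
  · rintro τ ⟨t, ht, hτ⟩
    simp only at hτ ⊢
    rw [← hτ, h.fluidCurve_properTime hΦ hw1]
    exact h.fluidLine_mem_region hw ht
  · rintro τ ⟨t, ht, hτ⟩
    refine HasDerivAt.hasDerivWithinAt ?_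
    simp only at hτ ⊢
    rw [← hτ, h.fluidCurve_properTime hΦ hw1, h.comovingField_fluidLine hw1 ht]
    refine HasDerivAt.comp_sub_const τ a ?_
    rw [← hτ]
    exact h.hasDerivAt_fluidCurve hΦ hw1 t

/-- If `u = c (t ∂_t + k ∂_r)`, then `t` and each component of `f(r) x/r` have derivative `c` times
themselves, so their quotients are constant on the interval `I`. This pins the curve to one line
`w`; proper time along that line minus `τ` then has derivative zero too, which fixes the shift `a`.
-/
theorem integralCurve_eq {ε : ℝ} (hε : 0 ≤ ε) {γ : ℝ → R4} {I : Set ℝ}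
    (hγ : IsIntegralCurveIn (region f ε) (comovingField f Φ) γ I) :
    ∃ (w : R4) (a : ℝ), (1 + ε) * radius w < 1 ∧ ∀ τ ∈ I, 0 < γ τ 0 ∧
      fluidVelocity F (γ τ) = w ∧ fluidLine F w (γ τ 0) = γ τ ∧
      properTime f Φ F D w (γ τ 0) = τ - a := by
  obtain ⟨⟨τ₀, hτ₀⟩, hI, hI', hM, hd⟩ := hγ
  have hconn : IsPreconnected I := hI'.isPreconnected
  have hd' : ∀ τ ∈ I, HasDerivAt γ (comovingField f Φ (γ τ)) τ := fun τ hτ =>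
    (hd τ hτ).hasDerivAt (hI.mem_nhds hτ)
  have hpos : ∀ τ ∈ I, 0 < γ τ 0 := fun τ hτ => h.time_pos_of_mem_region hε (hM hτ)
  have hd0 : ∀ τ ∈ I, HasDerivAt (fun τ => γ τ 0) (comovingField f Φ (γ τ) 0) τ := fun τ hτ =>
    hasDerivAt_pi.1 (hd' τ hτ) 0
  have hvel : ∀ i, ∀ τ ∈ I, HasDerivAt (fun τ => fluidVelocity F (γ τ) i) 0 τ := by
    intro i τ hτ
    by_cases hi : i = 0
    · simp only [fluidVelocity, hi, if_true]
      exact hasDerivAt_const τ 0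
    · simp only [fluidVelocity, hi, if_false]
      obtain ⟨c, hc, hu⟩ := h.comovingField_apply (Φ := Φ) hε (hM hτ)
      have h1 := (h.profile.hasFDerivAt_radialField hi (γ τ)).comp_hasDerivAt τ (hd' τ hτ)
      refine (h1.div (hd0 τ hτ) (hpos τ hτ).ne').congr_deriv ?_
      have h2 : ∀ j : Fin 4, j ≠ 0 → comovingField f Φ (γ τ) j
          = c * dslope k 0 (radius (γ τ)) * γ τ j := fun j hj => by
        rw [hu, Pi.smul_apply, radialFlow_of_ne k _ hj, radialField, smul_eq_mul, mul_assoc]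
      rw [radialFieldDeriv_apply hi h2, hu, Pi.smul_apply, radialFlow_zero, smul_eq_mul,
        Function.comp_apply, radialField]
      rcases eq_or_ne (radius (γ τ)) 0 with hr | hr
      · simp [apply_eq_zero_of_radius_eq_zero hr hi]
      · rw [h.profile.dslope_of_ne hr, h.quotient.dslope_of_ne hr,
          ← h.quotient_mul _ (radius_nonneg _)]
        field_simp
        ring
  have hconst : ∀ τ ∈ I, fluidVelocity F (γ τ) = fluidVelocity F (γ τ₀) := fun τ hτ => by
    funext i
    exact hI.is_const_of_deriv_eq_zero hconn
      (fun s hs => (hvel i s hs).differentiableAt.differentiableWithinAt)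
      (fun s hs => (hvel i s hs).deriv) hτ hτ₀
  set w := fluidVelocity F (γ τ₀) with hw
  have hw1 : (1 + ε) * radius w < 1 := by
    rw [(h.fluidVelocity_spec (hpos τ₀ hτ₀)).1, mul_div_assoc', div_lt_one (hpos τ₀ hτ₀)]
    exact h.mem_region.1 (hM hτ₀)
  have hw2 : radius w < 1 := by nlinarith [radius_nonneg w, mul_nonneg hε (radius_nonneg w)]
  have hline : ∀ τ ∈ I, fluidLine F w (γ τ 0) = γ τ := fun τ hτ => by
    rw [← hconst τ hτ]
    exact (h.fluidVelocity_spec (hpos τ hτ)).2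
  have hA : ∀ τ ∈ I, HasDerivAt (fun τ => properTime f Φ F D w (γ τ 0) - τ) 0 τ := fun τ hτ => by
    have h1 := ((h.hasDerivAt_properTime hΦ w (γ τ 0)).comp τ (hd0 τ hτ)).sub (hasDerivAt_id τ)
    refine h1.congr_deriv ?_
    have h2 := h.comovingField_fluidLine (Φ := Φ) hw2 (hpos τ hτ)
    rw [hline τ hτ] at h2
    rw [h2, Pi.smul_apply, smul_eq_mul]
    simp only [fluidLineDeriv, if_true, mul_one]
    rw [mul_inv_cancel₀ (h.properTimeRate_pos hw2 _).ne', sub_self]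
  refine ⟨w, -(properTime f Φ F D w (γ τ₀ 0) - τ₀), hw1, fun τ hτ =>
    ⟨hpos τ hτ, hconst τ hτ, hline τ hτ, ?_⟩⟩
  have := hI.is_const_of_deriv_eq_zero hconn
    (fun s hs => (hA s hs).differentiableAt.differentiableWithinAt)
    (fun s hs => (hA s hs).deriv) hτ hτ₀
  linarith

theorem isGLB_fluidCurve_domain {w : R4} (hw : radius w < 1) (a : ℝ) :
    IsGLB ((fun τ => τ - a) ⁻¹' (properTime f Φ F D w '' Ioi 0)) a := by
  have hmono := h.strictMono_properTime hΦ hw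
  have hcont : ContinuousAt (properTime f Φ F D w) 0 := (h.hasDerivAt_properTime hΦ w 0).continuousAt
  constructor
  · rintro τ ⟨t, ht, hτ⟩
    have := hmono (mem_Ioi.1 ht)
    rw [properTime_zero] at this
    simp only at hτ
    linarith
  · intro x hx
    have h1 : Tendsto (fun t => properTime f Φ F D w t + a) (𝓝[>] 0) (𝓝 (0 + a)) := by
      have h2 := hcont.tendsto
      rw [properTime_zero] at h2
      exact (h2.mono_left nhdsWithin_le_nhds).add_const a
    rw [zero_add] at h1
    refine ge_of_tendsto h1 ?_
    filter_upwards [self_mem_nhdsWithin] with t ht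
    exact hx ⟨t, ht, by simp⟩

theorem fluidCurve_domain_mem_nhdsGT {w : R4} (hw : radius w < 1) (a : ℝ) :
    (fun τ => τ - a) ⁻¹' (properTime f Φ F D w '' Ioi 0) ∈ 𝓝[>] a := by
  have hmono := h.strictMono_properTime hΦ hw
  have hcont : Continuous (properTime f Φ F D w) :=
    continuous_iff_continuousAt.2 fun t => (h.hasDerivAt_properTime hΦ w t).continuousAt
  have h1 := intermediate_value_Ioo (zero_le_one' ℝ) (hcont.continuousOn (s := Icc 0 1))
  rw [properTime_zero] at h1
  have h2 := hmono (zero_lt_one' ℝ)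
  rw [properTime_zero] at h2
  filter_upwards [Ioo_mem_nhdsGT (show a < a + properTime f Φ F D w 1 by linarith)] with τ hτ
  exact image_mono Ioo_subset_Ioi_self (h1 ⟨by linarith [hτ.1], by linarith [hτ.2]⟩)

/-- The odd extension makes `fluidLine` and its proper time C¹ for all real `t`, with positive
proper time rate at `t = 0`. The one-sided statements at the origin are restrictions of two-sided
ones for `fluidCurve`. -/
theorem fluidCurve_origin {ε : ℝ} (hε : 0 ≤ ε) {w : R4} (hw : (1 + ε) * radius w < 1) {a : ℝ}
    {γ : ℝ → R4}
    (hγ : EqOn γ (fun τ => fluidCurve f Φ F D w (τ - a))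
      ((fun τ => τ - a) ⁻¹' (properTime f Φ F D w '' Ioi 0))) :
    Tendsto γ (𝓝[>] a) (𝓝 0) ∧
      HasDerivWithinAt (Function.update γ a 0)
        ((properTimeRate f Φ F D w 0)⁻¹ • fluidLineDeriv F D w 0) (Ici a) a ∧
      Tendsto (deriv γ) (𝓝[>] a)
        (𝓝 ((properTimeRate f Φ F D w 0)⁻¹ • fluidLineDeriv F D w 0)) := by
  have hw1 : radius w < 1 := by nlinarith [radius_nonneg w, mul_nonneg hε (radius_nonneg w)]
  have hJ := h.fluidCurve_domain_mem_nhdsGT hΦ hw1 a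
  have hopen := (h.isIntegralCurveIn_fluidCurve hΦ hε hw a).2.1
  have hd0 : HasDerivAt (fun τ => fluidCurve f Φ F D w (τ - a))
      ((properTimeRate f Φ F D w 0)⁻¹ • fluidLineDeriv F D w 0) a := by
    refine HasDerivAt.comp_sub_const a a ?_
    have := h.hasDerivAt_fluidCurve hΦ hw1 0
    rw [properTime_zero] at this
    rwa [sub_self]
  have hc0 : fluidCurve f Φ F D w 0 = 0 := by
    rw [← properTime_zero f Φ F D w, h.fluidCurve_properTime hΦ hw1, h.fluidLine_zero]
  refine ⟨?_, ?_, ?_⟩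
  · have h1 := hd0.continuousAt.tendsto
    simp only [sub_self, hc0] at h1
    refine (h1.mono_left nhdsWithin_le_nhds).congr' ?_
    filter_upwards [hJ] with τ hτ
    exact (hγ hτ).symm
  · refine hd0.hasDerivWithinAt.congr_of_eventuallyEq ?_ (by simp [hc0])
    rw [← Ioi_insert, EventuallyEq, nhdsWithin_insert, eventually_sup, eventually_pure]
    refine ⟨by simp [hc0], ?_⟩
    filter_upwards [hJ, self_mem_nhdsWithin] with τ hτ hτ'
    rw [Function.update_of_ne (ne_of_gt hτ')]
    exact hγ hτ
  · have hinv : HasDerivAt (Function.invFun (properTime f Φ F D w)) (properTimeRate f Φ F D w 0)⁻¹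
        (properTime f Φ F D w 0) :=
      _root_.hasDerivAt_invFun (h.hasDerivAt_properTime hΦ w) (h.continuous_properTimeRate hΦ w)
        (h.properTimeRate_pos hw1) 0
    have hl := Function.leftInverse_invFun (h.strictMono_properTime hΦ hw1).injective
    have h1 : ContinuousAt (fun t => (properTimeRate f Φ F D w t)⁻¹ • fluidLineDeriv F D w t) 0 :=
      ((h.continuous_properTimeRate hΦ w).continuousAt.inv₀
        (h.properTimeRate_pos hw1 0).ne').smul (h.continuous_fluidLineDeriv w).continuousAt
    have h2 : Tendsto (fun τ => Function.invFun (properTime f Φ F D w) (τ - a)) (𝓝[>] a) (𝓝 0) := by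
      have h3 := hinv.continuousAt.tendsto
      rw [hl, properTime_zero] at h3
      refine h3.comp ?_
      have h4 : Tendsto (fun τ => τ - a) (𝓝 a) (𝓝 (a - a)) :=
        (continuous_id.sub continuous_const).tendsto a
      rw [sub_self] at h4
      exact h4.mono_left nhdsWithin_le_nhds
    refine (h1.tendsto.comp h2).congr' ?_
    filter_upwards [hJ] with τ hτ
    obtain ⟨t, ht, hτt⟩ := hτ
    simp only at hτt
    have h5 : HasDerivAt (fun τ => fluidCurve f Φ F D w (τ - a))
        ((properTimeRate f Φ F D w t)⁻¹ • fluidLineDeriv F D w t) τ := by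
      refine HasDerivAt.comp_sub_const τ a ?_
      rw [← hτt]
      exact h.hasDerivAt_fluidCurve hΦ hw1 t
    have h6 : γ =ᶠ[𝓝 τ] fun τ => fluidCurve f Φ F D w (τ - a) :=
      hγ.eventuallyEq_of_mem (hopen.mem_nhds ⟨t, ht, hτt⟩)
    rw [h6.deriv_eq, h5.deriv, Function.comp_apply, ← hτt, hl]

theorem isOriginPoint {ε : ℝ} (hε : 0 ≤ ε) :
    IsOriginPoint (region f ε) (comovingField f Φ) 0 := by
  refine ⟨h.zero_notMem_region ε, fun γ I hγ => ?_⟩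
  obtain ⟨w, a, hw, hI⟩ := h.integralCurve_eq hΦ hε hγ.1
  have hw1 : radius w < 1 := by nlinarith [radius_nonneg w, mul_nonneg hε (radius_nonneg w)]
  have hEq : EqOn γ (fun τ => fluidCurve f Φ F D w (τ - a)) I := fun τ hτ => by
    obtain ⟨-, -, h1, h2⟩ := hI τ hτ
    simp only
    rw [← h2, h.fluidCurve_properTime hΦ hw1, h1]
  -- The fluid curve with the same `w` and `a` extends `γ` to all of `t > 0`; maximality identifies
  -- the two parameter intervals.
  have hJ := hγ.2 _ _ (h.isIntegralCurveIn_fluidCurve hΦ hε hw a)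
    (fun τ hτ => ⟨γ τ 0, (hI τ hτ).1, (hI τ hτ).2.2.2⟩) hEq
  rw [← hJ] at hEq
  obtain ⟨h1, h2, h3⟩ := h.fluidCurve_origin hΦ hε hw hEq
  exact ⟨a, hJ ▸ h.isGLB_fluidCurve_domain hΦ hw1 a, h1, _, h2, h3⟩

/-- The curve is the `t`-axis, the fluid line with `w = 0`. An integral curve extending it again
lies on a single fluid line, and agreement at one parameter forces `w = 0` and shift `0`, so its
interval is no larger. -/
theorem exists_isMaximalIntegralCurveIn {ε : ℝ} (hε : 0 ≤ ε) :
    ∃ (γ : ℝ → R4) (I : Set ℝ), IsMaximalIntegralCurveIn (region f ε) (comovingField f Φ) γ I ∧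
      IsGLB I 0 ∧ HasDerivWithinAt (Function.update γ 0 0) (Real.exp (-Φ 0) • coordVec 0)
        (Ici 0) 0 := by
  have hw : (1 + ε) * radius 0 < 1 := by simp [radius_zero]
  have hw1 : radius 0 < 1 := by simp [radius_zero]
  have hcurve := h.isIntegralCurveIn_fluidCurve hΦ hε hw 0
  have horigin := (h.fluidCurve_origin hΦ hε hw (a := 0) fun _ _ => rfl).2.1
  have hv : (properTimeRate f Φ F D 0 0)⁻¹ • fluidLineDeriv F D 0 0
      = Real.exp (-Φ 0) • coordVec 0 := by
    have h1 : fluidLineDeriv F D 0 0 = coordVec 0 := by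
      funext i
      simp [fluidLineDeriv, coordVec, Pi.single_apply]
    rw [h1, properTimeRate, h.fluidLine_zero, exampleFactor, zeta_zero, radius_zero, Real.exp_neg]
    simp
  rw [hv] at horigin
  refine ⟨_, _, ⟨hcurve, fun γ' J hγ' hJ hEq => ?_⟩, h.isGLB_fluidCurve_domain hΦ hw1 0, horigin⟩
  refine subset_antisymm (fun τ hτ => ?_) hJ
  obtain ⟨w, a, -, hI⟩ := h.integralCurve_eq hΦ hε hγ'
  obtain ⟨τ₀, t, ht, hτ₀⟩ := hcurve.1
  have hτ₀J : τ₀ ∈ J := hJ ⟨t, ht, hτ₀⟩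
  have hγτ₀ : γ' τ₀ = fluidLine F 0 t := by
    rw [← hEq ⟨t, ht, hτ₀⟩]
    simp only at hτ₀ ⊢
    rw [← hτ₀, h.fluidCurve_properTime hΦ hw1]
  obtain ⟨-, h2, -, h4⟩ := hI τ₀ hτ₀J
  have hw0 : w = 0 := by
    rw [← h2, hγτ₀]
    funext i
    by_cases hi : i = 0
    · simp [fluidVelocity, hi]
    · simp [fluidVelocity, radialField, fluidLine, hi]
  subst hw0
  have ha : a = 0 := by
    have h5 : γ' τ₀ 0 = t := by rw [hγτ₀]; simp [fluidLine]
    rw [h5, hτ₀] at h4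
    linarith
  subst ha
  exact ⟨γ' τ 0, (hI τ hτ).1, (hI τ hτ).2.2.2⟩

end IsProfileOf

/-! ### Continuous extensions and quadratic forms -/

theorem extendsContinuouslyTo_of_tendsto {α : Type*} [TopologicalSpace α] {M : Set R4} {O : R4}
    {F : R4 → α} {v : α} (hO : O ∉ M) (hF : ContinuousOn F M) (ht : Tendsto F (𝓝[M] O) (𝓝 v)) :
    ExtendsContinuouslyTo M O F v := by
  refine ⟨Function.update F O v, ?_, fun p hp => ?_, Function.update_self _ _ _⟩
  · rw [continuousOn_update_iff, insert_sdiff_self_of_notMem hO]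
    exact ⟨hF, fun _ => ht⟩
  · exact Function.update_of_ne (ne_of_mem_of_not_mem hp hO) _ _

theorem ExtendsContinuouslyTo.tendsto {α : Type*} [TopologicalSpace α] {M : Set R4} {O : R4}
    {F : R4 → α} {v : α} (h : ExtendsContinuouslyTo M O F v) : Tendsto F (𝓝[M] O) (𝓝 v) := by
  obtain ⟨F', hF', hEq, rfl⟩ := h
  refine ((hF' O (mem_insert _ _)).mono_left (nhdsWithin_mono _ (subset_insert _ _))).congr' ?_
  filter_upwards [self_mem_nhdsWithin] with p hp
  exact hEq hp

theorem Continuous.extendsContinuouslyTo {α : Type*} [TopologicalSpace α] {F : R4 → α}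
    (hF : Continuous F) (M : Set R4) (O : R4) : ExtendsContinuouslyTo M O F (F O) :=
  ⟨F, hF.continuousOn, fun _ _ => rfl, rfl⟩

theorem bil_eq_sum (A : Matrix (Fin 4) (Fin 4) ℝ) (v w : R4) :
    bil A v w = ∑ i, ∑ j, v i * w j * A i j := by
  simp only [bil, dotProduct, Matrix.mulVec, Finset.mul_sum]
  exact Finset.sum_congr rfl fun i _ => Finset.sum_congr rfl fun j _ => by ring

theorem bil_add_left (A B : Matrix (Fin 4) (Fin 4) ℝ) (v w : R4) :
    bil (A + B) v w = bil A v w + bil B v w := by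
  simp [bil, Matrix.add_mulVec, dotProduct_add]

theorem ContinuousOn.bil {M : Set R4} {A : TwoTensor} {v : R4 → R4} (hA : Continuous A)
    (hv : ContinuousOn v M) : ContinuousOn (fun p => bil (A p) (v p) (v p)) M := by
  simp only [bil_eq_sum]
  have h : ∀ i, ContinuousOn (fun p => v p i) M := continuousOn_pi.1 hv
  exact continuousOn_finsetSum _ fun i _ => continuousOn_finsetSum _ fun j _ =>
    ((h i).mul (h j)).mul (hA.matrix_elem i j).continuousOn

theorem tendsto_bil_zero {l : Filter R4} {A : TwoTensor} {v : R4 → R4} {C : ℝ}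
    (hA : Tendsto A l (𝓝 0)) (hv : ∀ᶠ p in l, ∀ i, |v p i| ≤ C) :
    Tendsto (fun p => bil (A p) (v p) (v p)) l (𝓝 0) := by
  have hAij : ∀ i j, Tendsto (fun p => A p i j) l (𝓝 0) := fun i j =>
    ((continuous_id.matrix_elem i j).tendsto (0 : Matrix (Fin 4) (Fin 4) ℝ)).comp hA
  simp only [bil_eq_sum]
  have h0 : (0 : ℝ) = ∑ _i : Fin 4, ∑ _j : Fin 4, 0 := by simp
  rw [h0]
  refine tendsto_finsetSum _ fun i _ => tendsto_finsetSum _ fun j _ => ?_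
  refine squeeze_zero_norm' (a := fun p => C * C * |A p i j|) ?_ ?_
  · filter_upwards [hv] with p hp
    rw [Real.norm_eq_abs, abs_mul, abs_mul]
    exact mul_le_mul_of_nonneg_right (mul_le_mul (hp i) (hp j) (abs_nonneg _)
      ((abs_nonneg _).trans (hp i))) (abs_nonneg _)
  · simpa using (hAij i j).abs.const_mul (C * C)

/-! ### Vectors in a narrow cone -/

/-- Normalization reads `v₀² - |v|² = 1/E`, with `|v|` the spatial length; the cone condition `|v|²
≤ v₀²/q` then leaves `(1 - 1/q) v₀² ≤ 1/E`. -/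
theorem sq_apply_le_of_timelike {E q : ℝ} (hE : 0 < E) (hq : 1 < q) {v : R4}
    (hv : E * bil minkowski v v = -1) (hc : q * (v 1 ^ 2 + v 2 ^ 2 + v 3 ^ 2) ≤ v 0 ^ 2)
    (i : Fin 4) : v i ^ 2 ≤ q / (q - 1) * E⁻¹ := by
  rw [bil_minkowski] at hv
  have h1 : v 0 ^ 2 - (v 1 ^ 2 + v 2 ^ 2 + v 3 ^ 2) = E⁻¹ := by
    field_simp
    linarith
  have h0 : v 0 ^ 2 ≤ q / (q - 1) * E⁻¹ := by
    rw [div_mul_eq_mul_div, le_div_iff₀ (by linarith), ← h1]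
    linarith
  have hS : v 1 ^ 2 + v 2 ^ 2 + v 3 ^ 2 ≤ v 0 ^ 2 := by
    nlinarith [sq_nonneg (v 1), sq_nonneg (v 2), sq_nonneg (v 3)]
  fin_cases i <;> simp only [Fin.zero_eta, Fin.mk_one, Fin.reduceFinMk] <;>
    linarith [sq_nonneg (v 1), sq_nonneg (v 2), sq_nonneg (v 3)]

/-- Orthogonality is `u₀ e₀ = u · e` in the spatial parts. Cauchy–Schwarz and the cone condition on
`u` give `q e₀² ≤ |e|²`, so `e` stays away from the light cone from the outside and the timelike
estimate applies with the roles of time and space exchanged. -/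
theorem sq_apply_le_of_spacelike {E q : ℝ} (hE : 0 < E) (hq : 1 < q) {u e : R4} (hu : 0 < u 0)
    (hc : q * (u 1 ^ 2 + u 2 ^ 2 + u 3 ^ 2) ≤ u 0 ^ 2) (he : E * bil minkowski e e = 1)
    (hue : E * bil minkowski u e = 0) (i : Fin 4) : e i ^ 2 ≤ q / (q - 1) * E⁻¹ := by
  rw [bil_minkowski] at he hue
  have h1 : e 1 ^ 2 + e 2 ^ 2 + e 3 ^ 2 - e 0 ^ 2 = E⁻¹ := by
    field_simp
    linarith
  have h2 : u 0 * e 0 = u 1 * e 1 + u 2 * e 2 + u 3 * e 3 := by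
    rcases mul_eq_zero.1 hue with h | h
    · exact absurd h hE.ne'
    · linarith
  have hcs : (u 0 * e 0) ^ 2
      ≤ (u 1 ^ 2 + u 2 ^ 2 + u 3 ^ 2) * (e 1 ^ 2 + e 2 ^ 2 + e 3 ^ 2) := by
    rw [h2]
    nlinarith [sq_nonneg (u 1 * e 2 - u 2 * e 1), sq_nonneg (u 1 * e 3 - u 3 * e 1),
      sq_nonneg (u 2 * e 3 - u 3 * e 2)]
  have h3 : q * e 0 ^ 2 ≤ e 1 ^ 2 + e 2 ^ 2 + e 3 ^ 2 := by
    have h4 : 0 ≤ e 1 ^ 2 + e 2 ^ 2 + e 3 ^ 2 := by positivity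
    have h5 : u 0 ^ 2 * (q * e 0 ^ 2) ≤ u 0 ^ 2 * (e 1 ^ 2 + e 2 ^ 2 + e 3 ^ 2) := by
      calc u 0 ^ 2 * (q * e 0 ^ 2) = q * (u 0 * e 0) ^ 2 := by ring
        _ ≤ q * ((u 1 ^ 2 + u 2 ^ 2 + u 3 ^ 2) * (e 1 ^ 2 + e 2 ^ 2 + e 3 ^ 2)) :=
          mul_le_mul_of_nonneg_left hcs (by linarith)
        _ = q * (u 1 ^ 2 + u 2 ^ 2 + u 3 ^ 2) * (e 1 ^ 2 + e 2 ^ 2 + e 3 ^ 2) := by ring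
        _ ≤ _ := mul_le_mul_of_nonneg_right hc h4
    exact le_of_mul_le_mul_left h5 (by positivity)
  have h0 : e 1 ^ 2 + e 2 ^ 2 + e 3 ^ 2 ≤ q / (q - 1) * E⁻¹ := by
    rw [div_mul_eq_mul_div, le_div_iff₀ (by linarith), ← h1]
    linarith
  have h00 : e 0 ^ 2 ≤ e 1 ^ 2 + e 2 ^ 2 + e 3 ^ 2 := by
    nlinarith [sq_nonneg (e 0)]
  fin_cases i <;> simp only [Fin.zero_eta, Fin.mk_one, Fin.reduceFinMk] <;>
    linarith [sq_nonneg (e 1), sq_nonneg (e 2), sq_nonneg (e 3)]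

namespace IsProfileOf

variable {f F D k k' : ℝ → ℝ} (h : IsProfileOf f F D k k')
include h

/-! ### Local timelike convexity -/

theorem eventually_le_two_mul_radius : ∀ᶠ p in 𝓝 (0 : R4), F (radius p) ≤ 2 * radius p := by
  have h1 := (hasDerivAt_iff_isLittleO.1 (h.profile.hasDerivAt 0)).bound zero_lt_one
  have h2 : Tendsto radius (𝓝 0) (𝓝 0) := by
    simpa [radius_zero] using continuous_radius.tendsto 0
  filter_upwards [h2.eventually h1] with p hp
  rw [h.profile.map_zero, h.deriv_zero] at hp
  simp only [sub_zero, smul_eq_mul, mul_one, one_mul, Real.norm_eq_abs,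
    abs_of_nonneg (radius_nonneg p)] at hp
  linarith [le_abs_self (F (radius p) - radius p)]

theorem isLocallyTimelikeConvexAbout {Φ : ℝ → ℝ} (hΦ : ContDiff ℝ 2 Φ) {ε : ℝ} (hε : 0 ≤ ε)
    {γ : ℝ → R4}
    (hγ : HasDerivWithinAt (Function.update γ 0 0) (Real.exp (-Φ 0) • coordVec 0) (Ici 0) 0) :
    IsLocallyTimelikeConvexAbout (region f ε) (exampleMetric f Φ) 0 γ 0 := by
  -- A point with `|xⁱ| ≤ κ t` has `r ≤ 2κt`, and `F(r) ≤ 2r` near the origin, so `(1 + ε) F(r) ≤ 4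
  -- (1 + ε) κ t = t/2 < t`. The single number `δ = κ²` serves both as metric tolerance and as cone
  -- width.
  set κ : ℝ := 1 / (8 * (1 + ε)) with hκ
  have hκ0 : 0 < κ := by positivity
  have hκ1 : (1 + ε) * κ = 1 / 8 := by
    rw [hκ]
    field_simp
  have hκ2 : κ ≤ 1 / 8 := by nlinarith
  set δ : ℝ := κ ^ 2 with hδ
  have hδ0 : 0 < δ := by positivity
  have hδ1 : δ < 1 := by nlinarith
  have hcont : Continuous fun p => |Real.exp (2 * (exampleFactor f Φ p - Φ 0)) - 1| :=
    ((Real.continuous_exp.comp (continuous_const.mul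
      ((h.contDiff_exampleFactor hΦ).continuous.sub continuous_const))).sub continuous_const).abs
  have hclose : ∀ᶠ p in 𝓝 (0 : R4), |Real.exp (2 * (exampleFactor f Φ p - Φ 0)) - 1| < δ := by
    refine hcont.continuousAt.eventually_lt_const ?_
    simpa [exampleFactor, zeta_zero] using hδ0
  obtain ⟨s, hs, hball⟩ := Metric.mem_nhds_iff.1 (hclose.and h.eventually_le_two_mul_radius)
  -- Scaling the coordinates by `e^{Φ(0)}` turns `g` at the origin into `η` and `∂₀` into `e^{-Φ(0)}
  -- ∂_t`, the initial velocity of the axis curve.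
  set c : ℝ := Real.exp (Φ 0) with hc
  have hc0 : 0 < c := Real.exp_pos _
  let χ : OpenPartialHomeomorph R4 R4 :=
    { toFun := fun p => c • p
      invFun := fun q => c⁻¹ • q
      source := Metric.ball 0 s
      target := (fun q => c⁻¹ • q) ⁻¹' Metric.ball 0 s
      map_source' := fun p hp => by rwa [mem_preimage, inv_smul_smul₀ hc0.ne']
      map_target' := fun q hq => hq
      left_inv' := fun p _ => inv_smul_smul₀ hc0.ne' p
      right_inv' := fun q _ => smul_inv_smul₀ hc0.ne' q
      open_source := Metric.isOpen_ball
      open_target := Metric.isOpen_ball.preimage (continuous_const_smul c⁻¹)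
      continuousOn_toFun := (continuous_const_smul c).continuousOn
      continuousOn_invFun := (continuous_const_smul c⁻¹).continuousOn }
  have hvec : ∀ μ p, chartVec χ μ p = c⁻¹ • coordVec μ := fun μ p => by
    have : HasFDerivAt (fun q : R4 => c⁻¹ • q) (c⁻¹ • ContinuousLinearMap.id ℝ R4) (χ p) :=
      (hasFDerivAt_id (𝕜 := ℝ) (χ p)).fun_const_smul c⁻¹
    change fderiv ℝ (fun q : R4 => c⁻¹ • q) (χ p) (coordVec μ) = _
    rw [this.fderiv]
    rfl
  have hbil : ∀ p μ ν, bil (exampleMetric f Φ p) (chartVec χ μ p) (chartVec χ ν p)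
      = Real.exp (2 * (exampleFactor f Φ p - Φ 0)) * minkowski μ ν := fun p μ ν => by
    have h1 : bil minkowski (c⁻¹ • coordVec μ) (c⁻¹ • coordVec ν)
        = c⁻¹ ^ 2 * minkowski μ ν := by
      simp [bil, coordVec, Matrix.mulVec_smul]
      ring
    rw [hvec, hvec, exampleMetric_eq, bil_conformalMetric, h1, ← mul_assoc, hc, ← Real.exp_neg,
      ← Real.exp_nat_mul, ← Real.exp_add]
    congr 2
    push_cast
    ring
  refine ⟨δ, χ, hδ0, hδ1, (contDiff_const_smul c).contDiffOn,
    (contDiff_const_smul c⁻¹).contDiffOn, Metric.mem_ball_self hs, smul_zero c, fun μ ν => ?_,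
    fun p hp μ ν => ?_, ?_, ?_⟩
  · rw [hbil, exampleFactor, zeta_zero, sub_self, mul_zero, Real.exp_zero, one_mul]
  · rw [hbil, ← sub_one_mul, abs_mul]
    have h1 : |minkowski μ ν| ≤ 1 := by
      fin_cases μ <;> fin_cases ν <;> simp [minkowski]
    exact (mul_le_of_le_one_right (abs_nonneg _) h1).trans_lt (hball hp).1
  · rwa [hvec, hc, ← Real.exp_neg]
  · rintro _ ⟨q, hq, rfl⟩
    obtain ⟨hq1, hq2, hq3⟩ := mem_timelikeFuture_narrowMinkowski hδ0 hδ1 hκ0.le le_rfl hq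
    change c⁻¹ • q ∈ region f ε
    have hFr := (hball hq1).2
    have hq0 : 0 < (c⁻¹ • q) 0 := mul_pos (inv_pos.2 hc0) hq2
    have hqi : ∀ i : Fin 4, i ≠ 0 → (c⁻¹ • q) i ^ 2 ≤ (κ * (c⁻¹ • q) 0) ^ 2 := fun i hi => by
      refine sq_le_sq' ?_ ?_ <;> simp only [Pi.smul_apply, smul_eq_mul]
      · have := mul_le_mul_of_nonneg_left (abs_le.1 (hq3 i hi)).1 (inv_pos.2 hc0).le
        linarith
      · have := mul_le_mul_of_nonneg_left (abs_le.1 (hq3 i hi)).2 (inv_pos.2 hc0).le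
        linarith
    have hr : radius (c⁻¹ • q) ≤ 2 * (κ * (c⁻¹ • q) 0) := by
      refine Real.sqrt_le_iff.2 ⟨by positivity, ?_⟩
      nlinarith [hqi 1 (by simp), hqi 2 (by simp), hqi 3 (by simp)]
    rw [h.mem_region]
    calc (1 + ε) * F (radius (c⁻¹ • q)) ≤ (1 + ε) * (2 * (2 * (κ * (c⁻¹ • q) 0))) :=
          mul_le_mul_of_nonneg_left (by linarith) (by linarith)
      _ = 4 * ((1 + ε) * κ) * (c⁻¹ • q) 0 := by ring
      _ < (c⁻¹ • q) 0 := by rw [hκ1]; linarith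

theorem hasGeometricInitialConditions {Φ : ℝ → ℝ} (hΦ : ContDiff ℝ 2 Φ) {ε : ℝ} (hε : 0 ≤ ε) :
    HasGeometricInitialConditions (region f ε) (exampleMetric f Φ) timeOrientation
      (comovingField f Φ) 0 where
  spacetime := h.isSpacetime hΦ (h.isOpen_region ε) (h.isConnected_region ε) le_rfl
  extension := h.isSpacetime hΦ isOpen_univ isConnected_univ (by simp)
  proper hM := h.zero_notMem_region ε (hM ▸ mem_univ 0)
  field := h.isUnitFutureTimelikeField hΦ hε
  origin := h.isOriginPoint hΦ hε
  convex := by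
    obtain ⟨γ, I, hγ, hI, hd⟩ := h.exists_isMaximalIntegralCurveIn hΦ hε
    exact ⟨γ, I, 0, hγ, hI, h.isLocallyTimelikeConvexAbout hΦ hε hd⟩
  ricci_extends := ⟨_, (continuous_ricci_conformalMetric
    (h.contDiff_exampleFactor hΦ)).extendsContinuouslyTo _ _⟩
  stronglyCausal := stronglyCausalAt_conformalMetric _

/-! ### The perfect fluid limit -/

theorem comovingField_cone {Φ : ℝ → ℝ} {ε : ℝ} (hε : 0 ≤ ε) {p : R4} (hp : p ∈ region f ε) :
    0 < comovingField f Φ p 0 ∧ (1 + ε) ^ 2 * (comovingField f Φ p 1 ^ 2 +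
      comovingField f Φ p 2 ^ 2 + comovingField f Φ p 3 ^ 2) ≤ comovingField f Φ p 0 ^ 2 := by
  obtain ⟨c, hc, hu⟩ := h.comovingField_apply (Φ := Φ) hε hp
  have h1 := h.quotient_lt_of_mem_region hε hp
  have h2 := h.quotient_nonneg (radius_nonneg p)
  have h3 : ((1 + ε) * k (radius p)) ^ 2 ≤ p 0 ^ 2 := pow_le_pow_left₀ (by positivity) h1.le 2
  rw [hu]
  simp only [Pi.smul_apply, smul_eq_mul, radialFlow_zero, radialFlow_of_ne k p one_ne_zero,
    radialFlow_of_ne k p (show (2 : Fin 4) ≠ 0 by simp),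
    radialFlow_of_ne k p (show (3 : Fin 4) ≠ 0 by simp)]
  refine ⟨mul_pos hc (h.time_pos_of_mem_region hε hp), ?_⟩
  calc _ = c ^ 2 * ((1 + ε) ^ 2 *
        (radialField k 1 p ^ 2 + radialField k 2 p ^ 2 + radialField k 3 p ^ 2)) := by ring
    _ = c ^ 2 * ((1 + ε) * k (radius p)) ^ 2 := by
      rw [sum_sq_radialField h.quotient]
      ring
    _ ≤ c ^ 2 * p 0 ^ 2 := mul_le_mul_of_nonneg_left h3 (sq_nonneg c)
    _ = (c * p 0) ^ 2 := by ring

theorem eventually_inv_conformal_le {Φ : ℝ → ℝ} (hΦ : ContDiff ℝ 2 Φ) :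
    ∃ C, ∀ᶠ p in 𝓝 (0 : R4), (Real.exp (2 * exampleFactor f Φ p))⁻¹ ≤ C := by
  have hcont : Continuous fun p => (Real.exp (2 * exampleFactor f Φ p))⁻¹ :=
    (Real.continuous_exp.comp (continuous_const.mul (h.contDiff_exampleFactor hΦ).continuous)).inv₀
      fun p => (Real.exp_pos _).ne'
  refine ⟨(Real.exp (2 * exampleFactor f Φ 0))⁻¹ + 1, ?_⟩
  exact hcont.continuousAt.eventually_le_const (lt_add_one _)

theorem tendsto_bil_region {Φ : ℝ → ℝ} (hΦ : ContDiff ℝ 2 Φ) {ε : ℝ} {A : TwoTensor}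
    (hA : Continuous A) (hA0 : A 0 = 0) {v : R4 → R4} {K : ℝ} (hK : 0 ≤ K)
    (hv : ∀ p ∈ region f ε, ∀ i, v p i ^ 2 ≤ K * (Real.exp (2 * exampleFactor f Φ p))⁻¹) :
    Tendsto (fun p => bil (A p) (v p) (v p)) (𝓝[region f ε] 0) (𝓝 0) := by
  obtain ⟨C, hC⟩ := h.eventually_inv_conformal_le hΦ
  refine tendsto_bil_zero (C := √(K * C)) ?_ ?_
  · rw [← hA0]
    exact hA.continuousAt.continuousWithinAt
  · filter_upwards [self_mem_nhdsWithin, hC.filter_mono nhdsWithin_le_nhds] with p hp hpC i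
    exact Real.abs_le_sqrt ((hv p hp i).trans (mul_le_mul_of_nonneg_left hpC hK))

/-- The tensor `A = T + ρ g` is continuous and vanishes at the origin, so it suffices that `u` and
`e` have bounded components there. The bound `q/(q - 1)` with `q = (1 + ε)²` needs `ε > 0`. -/
theorem limitsToPerfectFluid {Φ : ℝ → ℝ} (hΦ : ContDiff ℝ 2 Φ) {ε : ℝ} (hε : 0 < ε) {ρ : ℝ}
    (hρ : energyMomentum (exampleMetric f Φ) 0 = -ρ • exampleMetric f Φ 0) :
    LimitsToPerfectFluid (region f ε) (exampleMetric f Φ) (comovingField f Φ) 0 ρ (-ρ) := by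
  have hT : Continuous (energyMomentum (exampleMetric f Φ)) :=
    continuous_energyMomentum_conformalMetric (h.contDiff_exampleFactor hΦ)
  have hg : Continuous (exampleMetric f Φ) :=
    continuous_conformalMetric (h.contDiff_exampleFactor hΦ).continuous
  set A : TwoTensor := fun p => energyMomentum (exampleMetric f Φ) p + ρ • exampleMetric f Φ p
    with hAdef
  have hA : Continuous A := hT.add (hg.const_smul ρ)
  have hA0 : A 0 = 0 := by
    rw [hAdef]
    simp only
    rw [hρ, neg_smul, neg_add_cancel]
  have hbil : ∀ p v, bil (A p) v v
      = bil (energyMomentum (exampleMetric f Φ) p) v v + ρ * bil (exampleMetric f Φ p) v v :=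
    fun p v => by rw [hAdef, bil_add_left, bil_smul_left]
  have hq : 1 < (1 + ε) ^ 2 := by nlinarith
  have hK : 0 ≤ (1 + ε) ^ 2 / ((1 + ε) ^ 2 - 1) := div_nonneg (by positivity) (by linarith)
  have hE : ∀ p, 0 < Real.exp (2 * exampleFactor f Φ p) := fun p => Real.exp_pos _
  refine ⟨?_, fun e he he' => ?_, ?_⟩
  · refine extendsContinuouslyTo_of_tendsto (h.zero_notMem_region ε)
      (ContinuousOn.bil hT (h.contDiffOn_comovingField hΦ hε.le).continuousOn) ?_
    have h1 := h.tendsto_bil_region hΦ (ε := ε) hA hA0 (v := comovingField f Φ) hK fun p hp =>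
      sq_apply_le_of_timelike (hE p) hq
        ((bil_conformalMetric _ _ _ _).symm.trans (h.bil_comovingField hε.le hp))
        (h.comovingField_cone hε.le hp).2
    have h2 := h1.add_const ρ
    rw [zero_add] at h2
    refine h2.congr' ?_
    filter_upwards [self_mem_nhdsWithin] with p hp
    rw [hbil, h.bil_comovingField hε.le hp]
    ring
  · refine extendsContinuouslyTo_of_tendsto (h.zero_notMem_region ε) (ContinuousOn.bil hT he) ?_
    have h1 := h.tendsto_bil_region hΦ (ε := ε) hA hA0 (v := e) hK fun p hp =>
      sq_apply_le_of_spacelike (hE p) hq (h.comovingField_cone (Φ := Φ) hε.le hp).1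
        (h.comovingField_cone hε.le hp).2
        ((bil_conformalMetric _ _ _ _).symm.trans (he' p hp).1)
        ((bil_conformalMetric _ _ _ _).symm.trans (he' p hp).2)
    have h2 := h1.add_const (-ρ)
    rw [zero_add] at h2
    refine h2.congr' ?_
    filter_upwards [self_mem_nhdsWithin] with p hp
    rw [hbil, (he' p hp).1]
    ring
  -- For `p₀ = -ρ₀` the `u_* ⊗ u_*` term has coefficient zero, and the difference is `A` itself.
  · have h1 : (fun p => energyMomentum (exampleMetric f Φ) p
        - perfectFluid (exampleMetric f Φ) (comovingField f Φ) ρ (-ρ) p) = A := by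
      funext p
      rw [perfectFluid, add_neg_cancel, zero_smul, zero_add, neg_smul, sub_neg_eq_add]
    rw [h1, ← hA0]
    exact hA.extendsContinuouslyTo _ _

theorem perfectFluid_axis {Φ : ℝ → ℝ} {t : ℝ} (ht : 0 < t) (ρ₀ p₀ : ℝ) :
    perfectFluid (exampleMetric f Φ) (comovingField f Φ) ρ₀ p₀ (t • coordVec 0) 0 0
        = ρ₀ * Real.exp (2 * exampleFactor f Φ (t • coordVec 0)) ∧
      perfectFluid (exampleMetric f Φ) (comovingField f Φ) ρ₀ p₀ (t • coordVec 0) 1 1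
        = p₀ * Real.exp (2 * exampleFactor f Φ (t • coordVec 0)) := by
  set p : R4 := t • coordVec 0 with hp
  have hp0 : p 0 = t := by simp [hp, coordVec]
  have hpi : ∀ i : Fin 4, i ≠ 0 → p i = 0 := fun i hi => by simp [hp, coordVec, hi]
  have hr : radius p = 0 := by simp [radius, hpi]
  have hflow : radialFlow k p = t • coordVec 0 := by
    funext i
    by_cases hi : i = 0
    · simp [hi, radialFlow, hp0, coordVec]
    · simp [radialFlow_of_ne k p hi, radialField, hpi i hi, coordVec, hi]
  have hu : comovingField f Φ p = Real.exp (-exampleFactor f Φ p) • coordVec 0 := by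
    have h0 : p 0 ^ 2 - k (radius p) ^ 2 = t ^ 2 := by
      rw [hr, h.quotient.map_zero, hp0]
      ring
    rw [h.comovingField_eq (by rw [h0]; positivity), h0, Real.sqrt_sq ht.le, hflow, smul_smul,
      div_mul_cancel₀ _ ht.ne']
  have hlow : exampleMetric f Φ p *ᵥ comovingField f Φ p
      = -(Real.exp (exampleFactor f Φ p)) • coordVec 0 := by
    rw [hu, exampleMetric_eq, conformalMetric, Matrix.smul_mulVec, Matrix.mulVec_smul, smul_smul,
      ← Real.exp_add, show 2 * exampleFactor f Φ p + -exampleFactor f Φ p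
        = exampleFactor f Φ p by ring]
    funext i
    simp only [minkowski, Pi.smul_apply, Matrix.mulVec_diagonal, coordVec]
    fin_cases i <;> simp
  have hexp : Real.exp (2 * exampleFactor f Φ p)
      = Real.exp (exampleFactor f Φ p) * Real.exp (exampleFactor f Φ p) := by
    rw [← Real.exp_add, two_mul]
  have hg : ∀ i j, exampleMetric f Φ p i j = Real.exp (2 * exampleFactor f Φ p) * minkowski i j :=
    fun _ _ => rfl
  constructor
  · simp only [perfectFluid, Matrix.add_apply, Matrix.smul_apply, hlow, Matrix.vecMulVec_apply, hg]
    simp [minkowski, coordVec, hexp]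
    ring
  · simp only [perfectFluid, Matrix.add_apply, Matrix.smul_apply, hlow, Matrix.vecMulVec_apply, hg]
    simp [minkowski, coordVec]

/-- The positive `t`-axis lies in the region and `u` is `e^{-φ} ∂_t` on it, so the `tt` and `xx`
components of the third fluid condition determine `ρ₀` and `p₀` in the limit `t → 0`. -/
theorem perfectFluid_unique {Φ : ℝ → ℝ} (hΦ : ContDiff ℝ 2 Φ) {ε : ℝ} {ρ : ℝ}
    (hρ : energyMomentum (exampleMetric f Φ) 0 = -ρ • exampleMetric f Φ 0) {ρ₀ p₀ : ℝ}
    (hL : LimitsToPerfectFluid (region f ε) (exampleMetric f Φ) (comovingField f Φ) 0 ρ₀ p₀) :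
    ρ₀ = ρ ∧ p₀ = -ρ := by
  have hT : Continuous (energyMomentum (exampleMetric f Φ)) :=
    continuous_energyMomentum_conformalMetric (h.contDiff_exampleFactor hΦ)
  have haxis : Continuous fun t : ℝ => t • coordVec 0 := continuous_id.smul continuous_const
  have haxis0 : Tendsto (fun t : ℝ => t • coordVec 0) (𝓝[>] 0) (𝓝[region f ε] 0) := by
    refine tendsto_nhdsWithin_iff.2 ⟨?_, ?_⟩
    · have := haxis.tendsto 0
      rw [zero_smul] at this
      exact this.mono_left nhdsWithin_le_nhds
    · filter_upwards [self_mem_nhdsWithin] with t ht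
      rw [h.mem_region]
      have : radius (t • coordVec 0) = 0 := by simp [radius, coordVec]
      rw [this, h.profile.map_zero]
      simpa [coordVec] using ht
  have hlim := hL.fluid.tendsto.comp haxis0
  have hE : Tendsto (fun t : ℝ => Real.exp (2 * exampleFactor f Φ (t • coordVec 0))) (𝓝[>] 0)
      (𝓝 (Real.exp (2 * Φ 0))) := by
    have h1 : Continuous fun t : ℝ => Real.exp (2 * exampleFactor f Φ (t • coordVec 0)) :=
      Real.continuous_exp.comp (continuous_const.mul
        ((h.contDiff_exampleFactor hΦ).continuous.comp haxis))
    have h2 := h1.tendsto 0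
    rw [zero_smul, exampleFactor, zeta_zero] at h2
    exact h2.mono_left nhdsWithin_le_nhds
  have hTij : ∀ i j, Tendsto (fun t : ℝ => energyMomentum (exampleMetric f Φ) (t • coordVec 0) i j)
      (𝓝[>] 0) (𝓝 (-ρ * (Real.exp (2 * Φ 0) * minkowski i j))) := fun i j => by
    have h1 := ((hT.matrix_elem i j).comp haxis).tendsto 0
    have h2 : energyMomentum (exampleMetric f Φ) ((0 : ℝ) • coordVec 0) i j
        = -ρ * (Real.exp (2 * Φ 0) * minkowski i j) := by
      rw [zero_smul, hρ, Matrix.smul_apply, exampleMetric_eq, conformalMetric_apply, exampleFactor,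
        zeta_zero, smul_eq_mul]
    rw [Function.comp_apply, h2] at h1
    exact h1.mono_left nhdsWithin_le_nhds
  have hdiff : ∀ i j, Tendsto (fun t : ℝ =>
      energyMomentum (exampleMetric f Φ) (t • coordVec 0) i j
        - perfectFluid (exampleMetric f Φ) (comovingField f Φ) ρ₀ p₀ (t • coordVec 0) i j)
      (𝓝[>] 0) (𝓝 0) := fun i j =>
    ((continuous_id.matrix_elem i j).tendsto (0 : Matrix (Fin 4) (Fin 4) ℝ)).comp hlim
  have he := Real.exp_pos (2 * Φ 0)
  constructor
  · have h1 := (hTij 0 0).sub (hE.const_mul ρ₀)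
    have h2 := tendsto_nhds_unique (h1.congr' ?_) (hdiff 0 0)
    · simp [minkowski] at h2
      exact mul_left_cancel₀ he.ne' (by linarith)
    · filter_upwards [self_mem_nhdsWithin] with t ht
      rw [(h.perfectFluid_axis ht ρ₀ p₀).1]
  · have h1 := (hTij 1 1).sub (hE.const_mul p₀)
    have h2 := tendsto_nhds_unique (h1.congr' ?_) (hdiff 1 1)
    · simp [minkowski] at h2
      exact mul_left_cancel₀ he.ne' (by linarith)
    · filter_upwards [self_mem_nhdsWithin] with t ht
      rw [(h.perfectFluid_axis ht ρ₀ p₀).2]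

end IsProfileOf

theorem mainTheorem2 (f Φ : ℝ → ℝ)
    (hf_smooth : ContDiffOn ℝ ∞ f (Ici 0))
    (hf_pos : ∀ r, 0 < r → 0 < f r)
    (hf_zero : (fun r => f r - r) =O[𝓝[≥] 0] fun r => r ^ 3)
    (hf_deriv : ∀ r, 0 ≤ r → 1 ≤ deriv₀ f r)
    (hΦ : ContDiff ℝ ∞ Φ) :
    IsSpacetime 2 univ (exampleMetric f Φ) timeOrientation ∧
    HasGeometricInitialConditions {p : R4 | f (radius p) < p 0} (exampleMetric f Φ)
      timeOrientation (comovingField f Φ) 0 ∧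
    ∀ ε : ℝ, 0 < ε → ∀ ρ : ℝ,
      ρ = 3 / (4 * Real.pi) * Real.exp (-2 * Φ 0) * deriv Φ 0 →
      HasGeometricInitialConditions (region f ε) (exampleMetric f Φ)
        timeOrientation (comovingField f Φ) 0 ∧
      LimitsToPerfectFluid (region f ε) (exampleMetric f Φ) (comovingField f Φ) 0 ρ (-ρ) ∧
      (∀ ρ₀ p₀ : ℝ,
        LimitsToPerfectFluid (region f ε) (exampleMetric f Φ) (comovingField f Φ) 0 ρ₀ p₀ →
        ρ₀ = ρ ∧ p₀ = -ρ) ∧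
      ExtendsContinuouslyTo (region f ε) 0 (ricci (exampleMetric f Φ))
        ((8 * Real.pi * ρ) • exampleMetric f Φ 0) ∧
      ricci (exampleMetric f Φ) 0 = (8 * Real.pi * ρ) • exampleMetric f Φ 0 := by
  obtain ⟨F, D, k, k', h⟩ := exists_isProfileOf hf_smooth hf_zero hf_deriv
  have hΦ2 : ContDiff ℝ 2 Φ := hΦ.of_le (by norm_cast)
  refine ⟨h.isSpacetime hΦ2 isOpen_univ isConnected_univ le_rfl, ?_, fun ε hε ρ hρ => ?_⟩
  -- `M` is the case `ε = 0` of the regions; only the fluid limit requires `ε > 0`.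
  · rw [← region_zero]
    exact h.hasGeometricInitialConditions hΦ2 le_rfl
  have hg0 : exampleMetric f Φ 0 = Real.exp (2 * Φ 0) • minkowski := by
    rw [exampleMetric, zeta_zero]
  have hρ' : ρ * Real.exp (2 * Φ 0) = 3 * deriv Φ 0 / (4 * Real.pi) := by
    rw [hρ, neg_mul, Real.exp_neg]
    have := (Real.exp_pos (2 * Φ 0)).ne'
    field_simp
  have hT : energyMomentum (exampleMetric f Φ) 0 = -ρ • exampleMetric f Φ 0 := by
    rw [h.energyMomentum_exampleMetric_zero hΦ2, hg0, smul_smul, neg_mul, hρ']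
  have hR : ricci (exampleMetric f Φ) 0 = (8 * Real.pi * ρ) • exampleMetric f Φ 0 := by
    rw [h.ricci_exampleMetric_zero hΦ2, hg0, smul_smul, mul_assoc, hρ']
    congr 1
    have := Real.pi_pos.ne'
    field_simp
    ring
  refine ⟨h.hasGeometricInitialConditions hΦ2 hε.le, h.limitsToPerfectFluid hΦ2 hε hT,
    fun ρ₀ p₀ => h.perfectFluid_unique hΦ2 hT, ?_, hR⟩
  rw [← hR]
  exact (continuous_ricci_conformalMetric
    (h.contDiff_exampleFactor hΦ2)).extendsContinuouslyTo _ _
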